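/- Let $(M,g)$ be a globally hyperbolic (time-oriented) spacetime with volume measure $d\mathrm{Vol}_g$, and let $V=V_{[-1]}\oplus V_{[0]}\oplus V_{[1]}$ be a graded complex vector bundle of finite rank over $M$ (the degree is called ghost number) whose summands carry smooth, fiberwise non-degenerate (not necessarily positive) hermitian forms; give $V$ the direct sum form, and put $(u|v)_V=\int_M (u(x),v(x))_V\,d\mathrm{Vol}_g$, antilinear in $u$. Write $\Gamma,\Gamma_{\rm c},\Gamma_{\rm sc}$ for smooth, compactly supported smooth and space-compact smooth sections (those with support in $J^+(K)\cup J^-(K)$ for some compact $K$), $A^*$ for the formal adjoint of a differential operator $A$, $A|_E$ for the restriction of $A$ to $E$, and, for $F\subset E\subset\Gamma(M;V)$, $E/F\big|_{[i]}=\big(E\cap\Gamma(M;V_{[i]})\big)/\big(F\cap\Gamma(M;V_{[i]})\big)$. Let $\gamma$ and $L$ be differential operators on $\Gamma(M;V)$ such that 1. $\gamma^2=0$, $\gamma\,\Gamma(M;V_{[i]})\subset\Gamma(M;V_{[i-1]})$ (with $V_{[i]}=0$ for $i\notin\{-1,0,1\}$), and $\frac{\mathrm{Ker}\,\gamma|_{\Gamma_{\rm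 c}}}{\mathrm{Ran}\,\gamma|_{\Gamma_{\rm c}}}\big|_{[-1]}=\{0\}$; 2. $L=L^*$ is Green hyperbolic (it has retarded and advanced propagators $G_L^\pm$; put $G_L=G_L^+-G_L^-$), $\gamma^*L=L\gamma$, and $L\,\Gamma(M;V_{[i]})\subset\Gamma(M;V_{[-i]})$. Let $\Sigma\subset M$ be a smooth spacelike Cauchy surface, $V_\rho$ a hermitian vector bundle over $\Sigma$, and let $\rho$, a differential operator composed with the restriction to $\Sigma$, be a Cauchy data map for $L$: it maps $\Gamma_{\rm sc}(M;V)$ to $\Gamma_{\rm c}(\Sigma;V_\rho)$, and for each $\varphi\in\Gamma_{\rm c}(\Sigma;V_\rho)$ there is a unique $U_L\varphi:=f\in\Gamma_{\rm sc}(M;V)$ with $Lf=0$, $\rho f=\varphi$. Let $V_\rho$ be graded so that $\rho$ preserves the ghost number. Put $\gamma_\Sigma=\rho\,\gamma\,U_L$ on $\Gamma_{\rm c}(\Sigma;V_\rho)$. Then: (a) $\gamma_\Sigma$ maps $\Gamma_{\rm c}(\Sigma;V_\rho)$ to itself, $\rho$ and $G_L$ induce well-defined bijective linear maps $$[\rho]:\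 \frac{\mathrm{Ker}\,L|_{\Gamma_{\rm sc}}\cap\mathrm{Ker}\,\gamma|_{\Gamma_{\rm sc}}}{\mathrm{Ran}\,G_L\gamma^*|_{\Gamma_{\rm c}}}\Big|_{[0]}\longrightarrow \mathcal V_\Sigma:=\frac{\mathrm{Ker}\,\gamma_\Sigma|_{\Gamma_{\rm c}}}{\mathrm{Ran}\,\gamma_\Sigma|_{\Gamma_{\rm c}}}\Big|_{[0]},$$ $$[G_L]:\ \mathcal V:=\frac{\mathrm{Ker}\,\gamma^*|_{\Gamma_{\rm c}}}{\mathrm{Ran}\,\gamma^*|_{\Gamma_{\rm c}}+(\mathrm{Ran}\,L|_{\Gamma_{\rm c}}\cap\mathrm{Ker}\,\gamma^*|_{\Gamma_{\rm c}})}\Big|_{[0]}\longrightarrow\frac{\mathrm{Ker}\,L|_{\Gamma_{\rm sc}}\cap\mathrm{Ker}\,\gamma|_{\Gamma_{\rm sc}}}{\mathrm{Ran}\,G_L\gamma^*|_{\Gamma_{\rm c}}}\Big|_{[0]},$$ and in each of these quotients the denominator is contained in the numerator. (b) There is a unique sesquilinear form $\sigma_\Sigma$ on $\Gamma_{\rm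 c}(\Sigma;V_\rho)$ with $\sigma_\Sigma(\rho G_Lu,\rho G_Lv)=(u|G_Lv)_V$ for all $u,v\in\Gamma_{\rm c}(M;V)$. A linear operator $G_{L\Sigma}:\Gamma_{\rm c}(\Sigma;V_\rho)\to\Gamma_{\rm c}(\Sigma;V_\rho)$ satisfies $G_L=-G_L\rho^*G_{L\Sigma}\rho G_L$ (in the weak sense, i.e. $(u|G_Lv)_V=(\rho G_Lu|G_{L\Sigma}\rho G_Lv)_{V_\rho}$ for all $u,v\in\Gamma_{\rm c}(M;V)$) if and only if $\sigma_\Sigma(\varphi,\psi)=(\varphi|G_{L\Sigma}\psi)_{V_\rho}$ for all $\varphi,\psi$. (c) The sesquilinear forms $\overline{[u]}\,q\,[v]={\rm i}^{-1}(u|G_Lv)_V$ on $\mathcal V$ and $\overline{[\varphi]}\,q_\Sigma[\psi]={\rm i}^{-1}\sigma_\Sigma(\varphi,\psi)$ on $\mathcal V_\Sigma$ (so $\overline{[\varphi]}\,q_\Sigma[\psi]={\rm i}^{-1}(\varphi|G_{L\Sigma}\psi)_{V_\rho}$ whenever $G_{L\Sigma}$ as in (b) exists) are well defined, and $[\rho]\circ[G_L]$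 is an isomorphism of the phase space $(\mathcal V,q)$ onto the phase space $(\mathcal V_\Sigma,q_\Sigma)$. -/

import Mathlib

open Set Filter Topology MeasureTheory Bundle
open scoped Manifold ContDiff

noncomputable section

/-! ## Lorentzian geometry -/

section Geometry

/-- A time-oriented Lorentzian metric, of signature `(-,+,…,+)`, on a manifold of dimension `n`.
The time orientation is given by a smooth timelike vector field `T`; the signature condition says
that the metric is negative on `T` and positive definite on its orthogonal complement. -/
structure TimeOrientedLorentzMetric (n : ℕ) (M : Type*) [TopologicalSpace M]
    [ChartedSpace (EuclideanSpace ℝ (Fin n)) M] [IsManifold (𝓡 n) ∞ M] where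
  g : ∀ x : M, TangentSpace (𝓡 n) x →L[ℝ] TangentSpace (𝓡 n) x →L[ℝ] ℝ
  symm : ∀ (x : M) (v w : TangentSpace (𝓡 n) x), g x v w = g x w v
  smooth : ContMDiff (𝓡 n) ((𝓡 n).prod
      𝓘(ℝ, EuclideanSpace ℝ (Fin n) →L[ℝ] EuclideanSpace ℝ (Fin n) →L[ℝ] ℝ)) ∞
    (fun x ↦ TotalSpace.mk'
      (EuclideanSpace ℝ (Fin n) →L[ℝ] EuclideanSpace ℝ (Fin n) →L[ℝ] ℝ) x (g x))
  T : ∀ x : M, TangentSpace (𝓡 n) x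
  smooth_T : ContMDiff (𝓡 n) ((𝓡 n).prod 𝓘(ℝ, EuclideanSpace ℝ (Fin n))) ∞
    (fun x ↦ TotalSpace.mk' (EuclideanSpace ℝ (Fin n)) x (T x))
  timelike_T : ∀ x : M, g x (T x) (T x) < 0
  pos_orthogonal : ∀ (x : M) (w : TangentSpace (𝓡 n) x), g x (T x) w = 0 → w ≠ 0 → 0 < g x w w

variable {n : ℕ} {M : Type*} [TopologicalSpace M] [ChartedSpace (EuclideanSpace ℝ (Fin n)) M]

/-- The square root of the absolute value of the Gram determinant of the bilinear forms `b` with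
respect to the coordinate vector fields of the chart `e`, at the point with coordinates `y`. -/
def volumeDensity
    (b : ∀ x : M, TangentSpace (𝓡 n) x → TangentSpace (𝓡 n) x → ℝ)
    (e : OpenPartialHomeomorph M (EuclideanSpace ℝ (Fin n))) (y : EuclideanSpace ℝ (Fin n)) : ℝ :=
  Real.sqrt |Matrix.det (Matrix.of fun i j : Fin n ↦
    b (e.symm y)
      (mfderiv (𝓡 n) (𝓡 n) e.symm y (EuclideanSpace.single i (1 : ℝ)))
      (mfderiv (𝓡 n) (𝓡 n) e.symm y (EuclideanSpace.single j (1 : ℝ))))|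

/-- `μ` is the volume measure of the (pseudo-)Riemannian metric `b`: in every chart of the smooth
structure it is `√|det b_ij| dx`. -/
def IsVolumeMeasure [MeasurableSpace M]
    (b : ∀ x : M, TangentSpace (𝓡 n) x → TangentSpace (𝓡 n) x → ℝ)
    (μ : Measure M) : Prop :=
  ∀ e ∈ IsManifold.maximalAtlas (𝓡 n) ∞ M, ∀ A : Set M, MeasurableSet A → A ⊆ e.source →
    μ A = ∫⁻ y in e '' A, ENNReal.ofReal (volumeDensity b e y)

variable [IsManifold (𝓡 n) ∞ M]

namespace TimeOrientedLorentzMetric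

variable (S : TimeOrientedLorentzMetric n M)

/-- Future-directed causal tangent vectors. -/
def FutureCausal (x : M) (v : TangentSpace (𝓡 n) x) : Prop :=
  v ≠ 0 ∧ S.g x v v ≤ 0 ∧ S.g x (S.T x) v < 0

/-- Future-directed timelike tangent vectors. -/
def FutureTimelike (x : M) (v : TangentSpace (𝓡 n) x) : Prop :=
  S.g x v v < 0 ∧ S.g x (S.T x) v < 0

/-- There is a smooth future-directed causal curve `[0,1] → M` from `p` to `q`. -/
def CausalStep (p q : M) : Prop :=
  ∃ c : ℝ → M, ContMDiffOn 𝓘(ℝ, ℝ) (𝓡 n) ∞ c (Icc 0 1) ∧ c 0 = p ∧ c 1 = q ∧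
    ∀ t ∈ Icc (0 : ℝ) 1,
      S.FutureCausal (c t) (mfderivWithin 𝓘(ℝ, ℝ) (𝓡 n) c (Icc 0 1) t (1 : ℝ))

/-- `J⁺(K)`: the points of `K` and the endpoints of piecewise smooth future-directed causal curves
(finite concatenations of smooth ones) that start in `K`. -/
def JPlus (K : Set M) : Set M := {q | ∃ p ∈ K, Relation.ReflTransGen S.CausalStep p q}

/-- `J⁻(K)`. -/
def JMinus (K : Set M) : Set M := {p | ∃ q ∈ K, Relation.ReflTransGen S.CausalStep p q}

/-- Global hyperbolicity: there are no closed causal curves and all causal diamonds are compact. -/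
def IsGloballyHyperbolic : Prop :=
  (∀ p : M, ¬ Relation.TransGen S.CausalStep p p) ∧
    ∀ p q : M, IsCompact (S.JPlus {p} ∩ S.JMinus {q})

/-- A piecewise smooth future-directed timelike curve, parametrized by `ℝ` in such a way that its
breakpoints are among the integers. -/
def IsTimelikeCurve (c : ℝ → M) : Prop :=
  ∀ k : ℤ, ContMDiffOn 𝓘(ℝ, ℝ) (𝓡 n) ∞ c (Icc (k : ℝ) (k + 1)) ∧
    ∀ t ∈ Icc (k : ℝ) (k + 1), S.FutureTimelike (c t)
      (mfderivWithin 𝓘(ℝ, ℝ) (𝓡 n) c (Icc (k : ℝ) (k + 1)) t (1 : ℝ))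

/-- A Cauchy surface: a subset that is met exactly once by each inextendible timelike curve. -/
def IsCauchySurface (A : Set M) : Prop :=
  ∀ c : ℝ → M, S.IsTimelikeCurve c → (¬ ∃ p, Tendsto c atTop (𝓝 p)) →
    (¬ ∃ p, Tendsto c atBot (𝓝 p)) → ∃! t, c t ∈ A

variable {d : ℕ} {N : Type*} [TopologicalSpace N] [ChartedSpace (EuclideanSpace ℝ (Fin d)) N]

/-- The pullback of the metric along a map `ι`. -/
def pullback (ι : N → M) (y : N) (v w : TangentSpace (𝓡 d) y) : ℝ :=
  S.g (ι y) (mfderiv (𝓡 d) (𝓡 n) ι y v) (mfderiv (𝓡 d) (𝓡 n) ι y w)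

variable (d) in
/-- `ι` is a smooth embedding onto a Cauchy surface, and the latter is spacelike. -/
structure IsSpacelikeCauchyEmbedding (ι : N → M) : Prop where
  smooth : ContMDiff (𝓡 d) (𝓡 n) ∞ ι
  isEmbedding : IsEmbedding ι
  spacelike : ∀ (y : N) (v : TangentSpace (𝓡 d) y), v ≠ 0 → 0 < S.pullback ι y v v
  cauchy : S.IsCauchySurface (range ι)

end TimeOrientedLorentzMetric

end Geometry

/-! ## Sections of complex vector bundles

A smooth complex vector bundle over a real manifold is a bundle `V` with complex fibers `V x`,
modelled on a finite-dimensional complex space `F`, whose local trivializations are complex-linear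
(`VectorBundle ℂ F V`) with real-smooth transition functions (`ContMDiffVectorBundle ∞ F V (𝓡 n)`,
over the field `ℝ`). -/

section Sections

variable (n : ℕ) {M : Type*} [TopologicalSpace M] [ChartedSpace (EuclideanSpace ℝ (Fin n)) M]
  (F : Type*) [NormedAddCommGroup F] [NormedSpace ℂ F]
  (V : M → Type*) [∀ x, AddCommGroup (V x)] [∀ x, Module ℂ (V x)] [∀ x, TopologicalSpace (V x)]
  [TopologicalSpace (TotalSpace F V)] [FiberBundle F V]
  [VectorBundle ℂ F V] [VectorBundle ℝ F V]

/-- `Γ(M;V)`, the complex vector space of smooth sections. -/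
def SmoothSections : Submodule ℂ (∀ x, V x) where
  carrier := {u | ContMDiff (𝓡 n) ((𝓡 n).prod 𝓘(ℝ, F)) ∞ (fun x ↦ TotalSpace.mk' F x (u x))}
  add_mem' hu hv := hu.add_section hv
  zero_mem' := Bundle.contMDiff_zeroSection ℝ V
  smul_mem' a u hu := by
    intro x₀
    have h := hu x₀
    rw [contMDiffAt_section] at h ⊢
    have hL : ContMDiff 𝓘(ℝ, F) 𝓘(ℝ, F) ∞ (fun v : F ↦ a • v) :=
      (contDiff_const_smul a).contMDiff
    refine (hL.contMDiffAt.comp x₀ h).congr_of_eventuallyEq ?_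
    filter_upwards [(trivializationAt F V x₀).open_baseSet.mem_nhds
      (FiberBundle.mem_baseSet_trivializationAt' x₀)] with x hx
    exact ((trivializationAt F V x₀).linear ℂ hx).2 a (u x)

variable {n F V}

/-- Multiplication of a smooth section by a smooth real function. -/
def fsmul (f : C^∞⟮𝓡 n, M; 𝓘(ℝ, ℝ), ℝ⟯) (u : SmoothSections n F V) : SmoothSections n F V :=
  ⟨fun x ↦ (f x : ℂ) • u.1 x, by
    have h : ContMDiff (𝓡 n) ((𝓡 n).prod 𝓘(ℝ, F)) ∞
        (fun x ↦ TotalSpace.mk' F x (f x • u.1 x)) := f.contMDiff.smul_section u.2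
    exact h⟩

/-- The support of a section. -/
def secSupport (u : SmoothSections n F V) : Set M := closure {x | u.1 x ≠ 0}

theorem secSupport_zero : secSupport (0 : SmoothSections n F V) = ∅ := by
  simp [secSupport]

theorem secSupport_add (u v : SmoothSections n F V) :
    secSupport (u + v) ⊆ secSupport u ∪ secSupport v := by
  rw [secSupport, secSupport, secSupport, ← closure_union]
  refine closure_mono fun x hx ↦ ?_
  by_contra h
  simp only [mem_union, mem_ofPred_eq, not_or, not_not] at h
  exact hx (by simp [h.1, h.2])

theorem secSupport_smul (a : ℂ) (u : SmoothSections n F V) :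
    secSupport (a • u) ⊆ secSupport u :=
  closure_mono fun x hx h ↦ hx (by simp [h])

variable (n F V) in
/-- `Γ_c(M;V)`, the compactly supported smooth sections. -/
def CompactSections : Submodule ℂ (SmoothSections n F V) where
  carrier := {u | IsCompact (secSupport u)}
  add_mem' hu hv := (hu.union hv).of_isClosed_subset isClosed_closure (secSupport_add _ _)
  zero_mem' := by simp [secSupport_zero]
  smul_mem' a u hu := hu.of_isClosed_subset isClosed_closure (secSupport_smul a u)

variable (F V) in
/-- `Γ_sc(M;V)`, the space-compact smooth sections: those supported in `J⁺(K) ∪ J⁻(K)` for some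
compact set `K`. -/
def SpaceCompactSections [IsManifold (𝓡 n) ∞ M] (S : TimeOrientedLorentzMetric n M) :
    Submodule ℂ (SmoothSections n F V) where
  carrier := {u | ∃ K : Set M, IsCompact K ∧ secSupport u ⊆ S.JPlus K ∪ S.JMinus K}
  add_mem' := by
    rintro u v ⟨K, hK, hu⟩ ⟨K', hK', hv⟩
    refine ⟨K ∪ K', hK.union hK', fun x hx ↦ ?_⟩
    rcases secSupport_add u v hx with h | h
    · rcases hu h with ⟨p, hp, h⟩ | ⟨p, hp, h⟩
      · exact Or.inl ⟨p, Or.inl hp, h⟩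
      · exact Or.inr ⟨p, Or.inl hp, h⟩
    · rcases hv h with ⟨p, hp, h⟩ | ⟨p, hp, h⟩
      · exact Or.inl ⟨p, Or.inr hp, h⟩
      · exact Or.inr ⟨p, Or.inr hp, h⟩
  zero_mem' := ⟨∅, isCompact_empty, by simp [secSupport_zero]⟩
  smul_mem' a u := by
    rintro ⟨K, hK, hu⟩
    exact ⟨K, hK, (secSupport_smul a u).trans hu⟩

variable (n F V) in
/-- A hermitian structure: a smooth family of non-degenerate (not necessarily positive) hermitian
forms on the fibers, antilinear in the first argument. -/
structure HermitianStructure where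
  form : ∀ x, V x →ₗ⋆[ℂ] V x →ₗ[ℂ] ℂ
  hermitian : ∀ x (v w : V x), form x v w = starRingEnd ℂ (form x w v)
  nondegenerate : ∀ x (v : V x), (∀ w, form x v w = 0) → v = 0
  smooth : ∀ u v : SmoothSections n F V,
    ContMDiff (𝓡 n) 𝓘(ℝ, ℂ) ∞ (fun x ↦ form x (u.1 x) (v.1 x))

/-- `(u|v)_V = ∫ (u(x), v(x))_V dμ(x)`. -/
def HermitianStructure.pairing [MeasurableSpace M] (h : HermitianStructure n F V) (μ : Measure M)
    (u v : SmoothSections n F V) : ℂ := ∫ x, h.form x (u.1 x) (v.1 x) ∂μ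

variable (n F V) in
/-- A grading `V = V_[-1] ⊕ V_[0] ⊕ V_[1]` by smooth subbundles, given by the smooth fiberwise
projections `proj i` onto `V_[i]`; by convention `V_[i] = 0` for other `i`. -/
structure GhostGrading where
  proj : ℤ → ∀ x, V x →ₗ[ℂ] V x
  proj_proj : ∀ i j x (v : V x), proj i x (proj j x v) = if i = j then proj j x v else 0
  sum_proj : ∀ x (v : V x), proj (-1) x v + proj 0 x v + proj 1 x v = v
  proj_eq_zero : ∀ i x (v : V x), i ≠ -1 → i ≠ 0 → i ≠ 1 → proj i x v = 0
  smooth : ∀ i (u : SmoothSections n F V),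
    (fun x ↦ proj i x (u.1 x)) ∈ SmoothSections n F V

/-- `Γ(M;V_[i])` as a subspace of `Γ(M;V)`. -/
def GhostGrading.degree (P : GhostGrading n F V) (i : ℤ) : Submodule ℂ (SmoothSections n F V) where
  carrier := {u | ∀ x, P.proj i x (u.1 x) = u.1 x}
  add_mem' hu hv x := by simp [hu x, hv x]
  zero_mem' x := by simp
  smul_mem' a u hu x := by simp [hu x]

/-- `V` with the hermitian structure `h` is the direct sum of hermitian bundles `V_[i]`. -/
def GhostGrading.IsHermitian (P : GhostGrading n F V) (h : HermitianStructure n F V) : Prop :=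
  ∀ i j, i ≠ j → ∀ x (v w : V x), h.form x (P.proj i x v) (P.proj j x w) = 0

end Sections

/-! ## Differential operators -/

section Operators

variable {n : ℕ} {M : Type*} [TopologicalSpace M] [ChartedSpace (EuclideanSpace ℝ (Fin n)) M]
  {F : Type*} [NormedAddCommGroup F] [NormedSpace ℂ F]
  {V : M → Type*} [∀ x, AddCommGroup (V x)] [∀ x, Module ℂ (V x)] [∀ x, TopologicalSpace (V x)]
  [TopologicalSpace (TotalSpace F V)] [FiberBundle F V]
  [VectorBundle ℂ F V] [VectorBundle ℝ F V]

/-- A linear map `D` from smooth sections of `V → M` to (set-theoretic) sections of `W → N` is a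
differential operator of order at most `m` along `ι : N → M` if all its `(m+1)`-fold iterated
commutators with multiplications by smooth functions vanish, where a function `f` on `M` acts on
sections over `N` through `f ∘ ι`. Equivalently, the value of `D u` at `y` depends linearly on the
`m`-jet of `u` at `ι y`. -/
def IsDiffOpOfOrder {N : Type*} {W : N → Type*} [∀ y, AddCommGroup (W y)] [∀ y, Module ℂ (W y)]
    (ι : N → M) : ℕ → (SmoothSections n F V → ∀ y, W y) → Prop
  | 0, D => ∀ (f : C^∞⟮𝓡 n, M; 𝓘(ℝ, ℝ), ℝ⟯) (u : SmoothSections n F V) (y : N),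
      D (fsmul f u) y = (f (ι y) : ℂ) • D u y
  | m + 1, D => ∀ f : C^∞⟮𝓡 n, M; 𝓘(ℝ, ℝ), ℝ⟯,
      IsDiffOpOfOrder ι m (fun u y ↦ D (fsmul f u) y - (f (ι y) : ℂ) • D u y)

/-- `A ∈ Diff(M;V)`: differential operators of some finite order. -/
def IsDiffOp (A : SmoothSections n F V →ₗ[ℂ] SmoothSections n F V) : Prop :=
  ∃ m, IsDiffOpOfOrder (id : M → M) m (fun u ↦ (A u).1)

/-- `B` is the formal adjoint of `A`. -/
def IsFormalAdjoint [MeasurableSpace M] (h : HermitianStructure n F V) (μ : Measure M)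
    (A B : SmoothSections n F V →ₗ[ℂ] SmoothSections n F V) : Prop :=
  ∀ u ∈ CompactSections n F V, ∀ v ∈ CompactSections n F V,
    h.pairing μ (B u) v = h.pairing μ u (A v)

/-- `Ker A|_E = {u ∈ E | A u = 0}`. -/
def kerOn {X Y : Type*} [AddCommMonoid X] [Module ℂ X] [AddCommMonoid Y] [Module ℂ Y]
    (A : X →ₗ[ℂ] Y) (E : Submodule ℂ X) : Submodule ℂ X := E ⊓ LinearMap.ker A

/-- `Ran A|_E = {A u | u ∈ E}`. -/
def ranOn {X Y : Type*} [AddCommMonoid X] [Module ℂ X] [AddCommMonoid Y] [Module ℂ Y]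
    (A : X →ₗ[ℂ] Y) (E : Submodule ℂ X) : Submodule ℂ Y := E.map A

/-- `Ker γ*|_c` in ghost number `0`. -/
def brstNum (γs : SmoothSections n F V →ₗ[ℂ] SmoothSections n F V) (P : GhostGrading n F V) :
    Submodule ℂ (SmoothSections n F V) :=
  kerOn γs (CompactSections n F V) ⊓ P.degree 0

/-- `Ran γ*|_c + (Ran L|_c ∩ Ker γ*|_c)` in ghost number `0`. -/
def brstDen (γs L : SmoothSections n F V →ₗ[ℂ] SmoothSections n F V) (P : GhostGrading n F V) :
    Submodule ℂ (SmoothSections n F V) :=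
  (ranOn γs (CompactSections n F V) ⊔
    (ranOn L (CompactSections n F V) ⊓ kerOn γs (CompactSections n F V))) ⊓ P.degree 0

theorem brstNum_le (γs : SmoothSections n F V →ₗ[ℂ] SmoothSections n F V)
    (P : GhostGrading n F V) : brstNum γs P ≤ CompactSections n F V :=
  inf_le_left.trans inf_le_left

variable [IsManifold (𝓡 n) ∞ M] (S : TimeOrientedLorentzMetric n M)

/-- `G` is a two-sided inverse of `D` on `Γ_c` with `supp (G u) ⊆ J (supp u)`. Here `J` is `J⁺` for
retarded and `J⁻` for advanced propagators. -/
structure IsPropagator (J : Set M → Set M)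
    (D : SmoothSections n F V →ₗ[ℂ] SmoothSections n F V)
    (G : CompactSections n F V →ₗ[ℂ] SmoothSections n F V) : Prop where
  right_inv : ∀ u : CompactSections n F V, D (G u) = u
  left_inv : ∀ u w : CompactSections n F V, (w : SmoothSections n F V) = D u → G w = u
  support : ∀ u : CompactSections n F V, secSupport (G u) ⊆ J (secSupport (u : SmoothSections n F V))

/-- `D` possesses retarded and advanced propagators. -/
def HasPropagators (D : SmoothSections n F V →ₗ[ℂ] SmoothSections n F V) : Prop :=
  (∃ G, IsPropagator S.JPlus D G) ∧ ∃ G, IsPropagator S.JMinus D G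

/-- `D` is Green hyperbolic: `D` and its formal adjoint possess retarded and advanced
propagators. -/
def IsGreenHyperbolic [MeasurableSpace M] (h : HermitianStructure n F V) (μ : Measure M)
    (D : SmoothSections n F V →ₗ[ℂ] SmoothSections n F V) : Prop :=
  HasPropagators S D ∧
    ∃ D', IsDiffOp D' ∧ IsFormalAdjoint h μ D D' ∧ HasPropagators S D'

variable {S} in
/-- The causal propagator `G_D = G⁺_D - G⁻_D`. -/
def HasPropagators.causal {D : SmoothSections n F V →ₗ[ℂ] SmoothSections n F V}
    (hD : HasPropagators S D) : CompactSections n F V →ₗ[ℂ] SmoothSections n F V :=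
  hD.1.choose - hD.2.choose

/-- The abstract linearized BRST framework: a hermitian graded bundle `V`, a codifferential `γ`
with formal adjoint `γs` and with vanishing compactly supported homology in degree `-1`, and a
formally self-adjoint Green hyperbolic operator `L`, with `γs L = L γ` and
`L Γ(M;V_[i]) ⊆ Γ(M;V_[-i])`. -/
structure IsBRST [MeasurableSpace M] (μ : Measure M) (h : HermitianStructure n F V)
    (P : GhostGrading n F V) (γ γs L : SmoothSections n F V →ₗ[ℂ] SmoothSections n F V) :
    Prop where
  graded_hermitian : P.IsHermitian h
  diffOp_γ : IsDiffOp γ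
  diffOp_γs : IsDiffOp γs
  diffOp_L : IsDiffOp L
  adjoint : IsFormalAdjoint h μ γ γs
  γ_γ : ∀ u, γ (γ u) = 0
  degree_γ : ∀ i, ∀ u ∈ P.degree i, γ u ∈ P.degree (i - 1)
  homology : kerOn γ (CompactSections n F V) ⊓ P.degree (-1) ≤ ranOn γ (CompactSections n F V)
  green : IsGreenHyperbolic S h μ L
  selfAdjoint : IsFormalAdjoint h μ L L
  intertwine : ∀ u, γs (L u) = L (γ u)
  degree_L : ∀ i, ∀ u ∈ P.degree i, L u ∈ P.degree (-i)

/-! ## Cauchy data -/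

variable {d : ℕ} {N : Type*} [TopologicalSpace N] [ChartedSpace (EuclideanSpace ℝ (Fin d)) N]
  {F' : Type*} [NormedAddCommGroup F'] [NormedSpace ℂ F']
  {W : N → Type*} [∀ x, AddCommGroup (W x)] [∀ x, Module ℂ (W x)] [∀ x, TopologicalSpace (W x)]
  [TopologicalSpace (TotalSpace F' W)] [FiberBundle F' W]
  [VectorBundle ℂ F' W] [VectorBundle ℝ F' W]

/-- `ρ` is a Cauchy data map for `L` (i.e. `L` is Cauchy hyperbolic for `ρ`) on the Cauchy surface
embedded by `ι`: it is a differential operator followed by the restriction to the Cauchy surface, it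
maps `Γ_sc(M;V)` to `Γ_c(Σ;V_ρ)`, and the Cauchy problem `L f = 0`, `f ∈ Γ_sc(M;V)`, `ρ f = φ` is
uniquely solvable for each `φ ∈ Γ_c(Σ;V_ρ)`. -/
structure IsCauchyDataMap (L : SmoothSections n F V →ₗ[ℂ] SmoothSections n F V) (ι : N → M)
    (ρ : SmoothSections n F V →ₗ[ℂ] SmoothSections d F' W) : Prop where
  diffOp : ∃ m, IsDiffOpOfOrder ι m (fun u ↦ (ρ u).1)
  maps : ∀ f ∈ SpaceCompactSections F V S, ρ f ∈ CompactSections d F' W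
  cauchy : ∀ φ ∈ CompactSections d F' W, ∃! f, f ∈ SpaceCompactSections F V S ∧ L f = 0 ∧ ρ f = φ

namespace IsCauchyDataMap

variable {S} {L : SmoothSections n F V →ₗ[ℂ] SmoothSections n F V} {ι : N → M}
  {ρ : SmoothSections n F V →ₗ[ℂ] SmoothSections d F' W} (hρ : IsCauchyDataMap S L ι ρ)

/-- `ρ : Ker L|_sc → Γ_c(Σ;V_ρ)`, as a linear isomorphism. -/
def solutionEquiv : kerOn L (SpaceCompactSections F V S) ≃ₗ[ℂ] CompactSections d F' W :=
  LinearEquiv.ofBijective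
    (LinearMap.codRestrict (CompactSections d F' W)
      (ρ.domRestrict (kerOn L (SpaceCompactSections F V S))) fun f ↦ hρ.maps _ f.2.1)
    ⟨fun f f' hff' ↦ by
      have h : ρ f = ρ f' := congrArg Subtype.val hff'
      exact Subtype.ext <| (hρ.cauchy (ρ f') (hρ.maps _ f'.2.1)).unique
        ⟨f.2.1, f.2.2, h⟩ ⟨f'.2.1, f'.2.2, rfl⟩,
    fun φ ↦ by
      obtain ⟨f, ⟨hf, hLf, hφ⟩, -⟩ := hρ.cauchy φ.1 φ.2
      exact ⟨⟨f, hf, hLf⟩, Subtype.ext hφ⟩⟩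

/-- `U_L`, the solution operator of the Cauchy problem: `L U_L = 0` and `ρ U_L = 1`. -/
def U : CompactSections d F' W →ₗ[ℂ] SmoothSections n F V :=
  (kerOn L (SpaceCompactSections F V S)).subtype ∘ₗ hρ.solutionEquiv.symm.toLinearMap

/-- `γ_Σ = ρ γ U_L` on `Γ_c(Σ;V_ρ)`. -/
def gammaSigma (γ : SmoothSections n F V →ₗ[ℂ] SmoothSections n F V) :
    CompactSections d F' W →ₗ[ℂ] SmoothSections d F' W := ρ ∘ₗ γ ∘ₗ hρ.U

end IsCauchyDataMap

/-! ## Quotient spaces and induced maps -/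

/-- The quotient `E / F` of two subspaces `F ⊆ E`. -/
abbrev QuotSpace {X : Type*} [AddCommGroup X] [Module ℂ X] (E F : Submodule ℂ X) : Type _ :=
  E ⧸ F.submoduleOf E

/-- The class in `E / F` of an element of `E`. -/
abbrev QuotSpace.mk {X : Type*} [AddCommGroup X] [Module ℂ X] {E : Submodule ℂ X}
    (F : Submodule ℂ X) (u : E) : QuotSpace E F := Submodule.Quotient.mk u

/-- `A`, defined on `D`, restricts to a map `E₁ → E₂` which induces `e : E₁ / F₁ → E₂ / F₂`. -/
def IsInducedMap {X Y : Type*} [AddCommGroup X] [Module ℂ X] [AddCommGroup Y] [Module ℂ Y]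
    {D E₁ F₁ : Submodule ℂ X} {E₂ F₂ : Submodule ℂ Y} (A : D →ₗ[ℂ] Y) (hE : E₁ ≤ D)
    (e : QuotSpace E₁ F₁ → QuotSpace E₂ F₂) : Prop :=
  ∀ u : E₁, ∃ w : E₂, (w : Y) = A ⟨u, hE u.2⟩ ∧ e (QuotSpace.mk F₁ u) = QuotSpace.mk F₂ w

namespace IsCauchyDataMap

variable {S} {L : SmoothSections n F V →ₗ[ℂ] SmoothSections n F V} {ι : N → M}
  {ρ : SmoothSections n F V →ₗ[ℂ] SmoothSections d F' W} (hρ : IsCauchyDataMap S L ι ρ)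

/-- `Ker γ_Σ|_c` in ghost number `0`. -/
def cycles (γ : SmoothSections n F V →ₗ[ℂ] SmoothSections n F V) (Pρ : GhostGrading d F' W) :
    Submodule ℂ (SmoothSections d F' W) :=
  (LinearMap.ker (hρ.gammaSigma γ)).map (CompactSections d F' W).subtype ⊓ Pρ.degree 0

/-- `Ran γ_Σ|_c` in ghost number `0`. -/
def boundaries (γ : SmoothSections n F V →ₗ[ℂ] SmoothSections n F V) (Pρ : GhostGrading d F' W) :
    Submodule ℂ (SmoothSections d F' W) :=
  LinearMap.range (hρ.gammaSigma γ) ⊓ Pρ.degree 0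

end IsCauchyDataMap

/-- `Ker L|_sc ∩ Ker γ|_sc` in ghost number `0`. -/
def solNum (γ L : SmoothSections n F V →ₗ[ℂ] SmoothSections n F V) (P : GhostGrading n F V) :
    Submodule ℂ (SmoothSections n F V) :=
  (kerOn L (SpaceCompactSections F V S) ⊓ kerOn γ (SpaceCompactSections F V S)) ⊓ P.degree 0

/-- `Ran G γ*|_c` in ghost number `0`. The operator `γs` maps `Γ_c` to itself; `G` is applied to
those elements of `Γ_c` that lie in `Ran γs|_c`. -/
def solDen (γs : SmoothSections n F V →ₗ[ℂ] SmoothSections n F V)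
    (G : CompactSections n F V →ₗ[ℂ] SmoothSections n F V) (P : GhostGrading n F V) :
    Submodule ℂ (SmoothSections n F V) :=
  ranOn G ((ranOn γs (CompactSections n F V)).comap (CompactSections n F V).subtype) ⊓ P.degree 0

/-- `B` is the sesquilinear form `(φ, ψ) ↦ (φ|G_{LΣ} ψ)` on Cauchy data, determined by
`G = -G ρ* G_{LΣ} ρ G`. As `G* = -G`, pairing both sides with `u` turns this identity into
`(u|G v) = (ρ G u|G_{LΣ} ρ G v)` for all `u, v ∈ Γ_c(M;V)`. -/
def IsCauchyForm [MeasurableSpace M] (μ : Measure M) (h : HermitianStructure n F V)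
    (G : CompactSections n F V →ₗ[ℂ] SmoothSections n F V)
    (ρ : SmoothSections n F V →ₗ[ℂ] SmoothSections d F' W)
    (B : CompactSections d F' W →ₗ⋆[ℂ] CompactSections d F' W →ₗ[ℂ] ℂ) : Prop :=
  ∀ (u v : CompactSections n F V) (φ ψ : CompactSections d F' W),
    (φ : SmoothSections d F' W) = ρ (G u) → (ψ : SmoothSections d F' W) = ρ (G v) →
      B φ ψ = h.pairing μ u (G v)

/-- `T : Γ_c(Σ;V_ρ) → Γ_c(Σ;V_ρ)` satisfies `G = -G ρ* T ρ G`, i.e.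
`(u|G v) = (ρ G u|T ρ G v)` for all `u, v ∈ Γ_c(M;V)`. -/
def IsCauchyPropagator [MeasurableSpace M] [MeasurableSpace N] (μ : Measure M) (ν : Measure N)
    (h : HermitianStructure n F V) (hW : HermitianStructure d F' W)
    (G : CompactSections n F V →ₗ[ℂ] SmoothSections n F V)
    (ρ : SmoothSections n F V →ₗ[ℂ] SmoothSections d F' W)
    (T : CompactSections d F' W →ₗ[ℂ] CompactSections d F' W) : Prop :=
  ∀ (u v : CompactSections n F V) (ψ : CompactSections d F' W),
    (ψ : SmoothSections d F' W) = ρ (G v) →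
      h.pairing μ u (G v) = hW.pairing ν (ρ (G u)) (T ψ)

end Operators

end

/-! Write `G = G⁺ - G⁻` for the causal propagator of `L`. Two facts carry the theorem. First, `L` is
injective on Γ_c, the kernel of `G` is `L Γ_c` (`HasPropagators.exists_eq_map_of_causal_eq_zero`),
and the range of `G` is the space of all space-compact solutions
(`HasPropagators.exists_causal_eq`). Second, `γ* L = L γ` passes to the propagators: `γ G = G γ*`
(`IsBRST.γ_causal`). Both follow from uniqueness of solutions with bounded past or future
(`IsPropagator.eq_zero_of_hasBoundedPast`), which needs only compact causal diamonds and cutoff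
functions.

Hence `G` sends `Ker γ*` into `Ker γ`, and `G u = G γ* w` means that `u - γ* w` lies in `L Γ_c`;
this makes `[G_L]` well defined and injective. For surjectivity take a solution `f = G u` of degree
0 with `γ f = 0`. Then `G γ* u = 0`, so `γ* u = L w` with `w` compactly supported of degree -1. From
`L γ w = γ* γ* u = 0` one gets `γ w = 0`, so `w = γ z` by the homology hypothesis, and `u - L z` is
a source of `f` that is annihilated by `γ*` (`IsBRST.exists_causal_eq_of_mem_solNum`).

The map `ρ` is an isomorphism from space-compact solutions to Cauchy data, and `γ_Σ` is `γ`
transported along it, so `[ρ]` is a bijection as soon as the degrees match.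

Finally `(L w|G v) = (w|L G v) = 0`, so `(u|G v)` depends only on `G u` and `G v`, that is, on their
Cauchy data; this gives `σ_Σ`. Moreover `(γ* w|G v) = (w|γ G v)` and `(u|G γ* w) = (γ* u|G w)`
vanish on cycles, so `q` descends to the quotient, and `q_Σ` is its transport. -/

noncomputable section

/-! ### Local causality and the volume measure in charts -/

section ChartGeometry

variable {n : ℕ} {M : Type*} [TopologicalSpace M] [ChartedSpace (EuclideanSpace ℝ (Fin n)) M]
  [IsManifold (𝓡 n) ∞ M]

/-- The coordinate vector fields of a chart depend continuously on the base point and on the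
coordinate vector. -/
theorem continuousOn_mfderiv_chart_symm (x₀ : M) :
    ContinuousOn (fun p : EuclideanSpace ℝ (Fin n) × EuclideanSpace ℝ (Fin n) ↦
      (TotalSpace.mk' (EuclideanSpace ℝ (Fin n)) ((chartAt (EuclideanSpace ℝ (Fin n)) x₀).symm p.1)
        (mfderiv (𝓡 n) (𝓡 n) (chartAt (EuclideanSpace ℝ (Fin n)) x₀).symm p.1 p.2) :
        TangentBundle (𝓡 n) M))
      ((chartAt (EuclideanSpace ℝ (Fin n)) x₀).target ×ˢ univ) := by
  set e := chartAt (EuclideanSpace ℝ (Fin n)) x₀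
  have he : ContMDiffOn (𝓡 n) (𝓡 n) ∞ e.symm e.target := contMDiffOn_chart_symm
  have h := he.continuousOn_tangentMapWithin (by simp) e.open_target.uniqueMDiffOn
  have h2 := h.comp (s := e.target ×ˢ univ)
    (tangentBundleModelSpaceHomeomorph (𝓡 n)).symm.continuous.continuousOn (fun p hp ↦ by
      exact hp.1)
  refine h2.congr fun p hp ↦ ?_
  change _ = TotalSpace.mk' _ (e.symm p.1) (mfderivWithin (𝓡 n) (𝓡 n) e.symm e.target p.1 p.2)
  rw [mfderivWithin_of_isOpen e.open_target hp.1]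

namespace TimeOrientedLorentzMetric

variable (S : TimeOrientedLorentzMetric n M)

theorem continuousOn_apply {X : Type*} [TopologicalSpace X] {s : Set X} {b : X → M}
    {v w : ∀ m, TangentSpace (𝓡 n) (b m)}
    (hv : ContinuousOn (fun m ↦ (TotalSpace.mk' (EuclideanSpace ℝ (Fin n)) (b m) (v m) :
      TangentBundle (𝓡 n) M)) s)
    (hw : ContinuousOn (fun m ↦ (TotalSpace.mk' (EuclideanSpace ℝ (Fin n)) (b m) (w m) :
      TangentBundle (𝓡 n) M)) s) :
    ContinuousOn (fun m ↦ S.g (b m) (v m) (w m)) s := by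
  intro x hx
  have hf : ContinuousWithinAt b s x :=
    ((FiberBundle.continuousWithinAt_totalSpace (F := EuclideanSpace ℝ (Fin n))
      (E := (TangentSpace (𝓡 n) : M → Type _)) _).1 (hv x hx)).1
  have := (S.smooth.continuous.continuousAt.comp_continuousWithinAt hf).clm_bundle_apply₂
    (F₁ := EuclideanSpace ℝ (Fin n)) (F₂ := EuclideanSpace ℝ (Fin n))
    (F₃ := ℝ) (E₃ := Bundle.Trivial M ℝ) (hv x hx) (hw x hx)
  simp only [FiberBundle.continuousWithinAt_totalSpace] at this
  exact this.2

/-- The metric in the coordinates of a chart. -/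
def chartMetric (x₀ : M) (y v w : EuclideanSpace ℝ (Fin n)) : ℝ :=
  S.g ((chartAt (EuclideanSpace ℝ (Fin n)) x₀).symm y)
    (mfderiv (𝓡 n) (𝓡 n) (chartAt (EuclideanSpace ℝ (Fin n)) x₀).symm y v)
    (mfderiv (𝓡 n) (𝓡 n) (chartAt (EuclideanSpace ℝ (Fin n)) x₀).symm y w)

theorem continuousOn_chartMetric (x₀ : M) :
    ContinuousOn (fun p : EuclideanSpace ℝ (Fin n) × EuclideanSpace ℝ (Fin n) ×
      EuclideanSpace ℝ (Fin n) ↦ S.chartMetric x₀ p.1 p.2.1 p.2.2)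
      ((chartAt (EuclideanSpace ℝ (Fin n)) x₀).target ×ˢ univ) :=
  S.continuousOn_apply
    ((continuousOn_mfderiv_chart_symm x₀).comp (s := _ ×ˢ univ)
      (f := fun p : _ × _ × _ ↦ (p.1, p.2.1)) (by fun_prop) fun _ hp ↦ ⟨hp.1, trivial⟩)
    ((continuousOn_mfderiv_chart_symm x₀).comp (s := _ ×ˢ univ)
      (f := fun p : _ × _ × _ ↦ (p.1, p.2.2)) (by fun_prop) fun _ hp ↦ ⟨hp.1, trivial⟩)

/-- The time orientation, paired with tangent vectors given in the coordinates of a chart. -/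
def chartTime (x₀ : M) (y v : EuclideanSpace ℝ (Fin n)) : ℝ :=
  S.g ((chartAt (EuclideanSpace ℝ (Fin n)) x₀).symm y)
    (S.T ((chartAt (EuclideanSpace ℝ (Fin n)) x₀).symm y))
    (mfderiv (𝓡 n) (𝓡 n) (chartAt (EuclideanSpace ℝ (Fin n)) x₀).symm y v)

theorem continuousOn_chartTime (x₀ : M) :
    ContinuousOn (fun p : EuclideanSpace ℝ (Fin n) × EuclideanSpace ℝ (Fin n) ↦
      S.chartTime x₀ p.1 p.2)
      ((chartAt (EuclideanSpace ℝ (Fin n)) x₀).target ×ˢ univ) :=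
  S.continuousOn_apply
    (S.smooth_T.continuous.comp_continuousOn
      ((chartAt (EuclideanSpace ℝ (Fin n)) x₀).continuousOn_symm.comp continuousOn_fst
        fun _ hp ↦ hp.1))
    (continuousOn_mfderiv_chart_symm x₀)

theorem chartMetric_smul (x₀ : M) (y v : EuclideanSpace ℝ (Fin n)) (a : ℝ) :
    S.chartMetric x₀ y (a • v) (a • v) = a * a * S.chartMetric x₀ y v v := by
  have h : mfderiv (𝓡 n) (𝓡 n) (chartAt (EuclideanSpace ℝ (Fin n)) x₀).symm y (a • v) =
      a • mfderiv (𝓡 n) (𝓡 n) (chartAt (EuclideanSpace ℝ (Fin n)) x₀).symm y v :=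
    ContinuousLinearMap.map_smul _ a v
  rw [chartMetric, h]
  simp [chartMetric, mul_assoc]

theorem chartTime_smul (x₀ : M) (y v : EuclideanSpace ℝ (Fin n)) (a : ℝ) :
    S.chartTime x₀ y (a • v) = a * S.chartTime x₀ y v := by
  have h : mfderiv (𝓡 n) (𝓡 n) (chartAt (EuclideanSpace ℝ (Fin n)) x₀).symm y (a • v) =
      a • mfderiv (𝓡 n) (𝓡 n) (chartAt (EuclideanSpace ℝ (Fin n)) x₀).symm y v :=
    ContinuousLinearMap.map_smul _ a v
  rw [chartTime, h]
  simp [chartTime]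

/-- A straight line in a chart with future-directed causal velocities is a causal curve. -/
theorem causalStep_of_segment (x₀ : M) {y z : EuclideanSpace ℝ (Fin n)}
    (hseg : segment ℝ y z ⊆ (chartAt (EuclideanSpace ℝ (Fin n)) x₀).target)
    (hg : ∀ p ∈ segment ℝ y z, S.chartMetric x₀ p (z - y) (z - y) ≤ 0)
    (hT : ∀ p ∈ segment ℝ y z, S.chartTime x₀ p (z - y) < 0) :
    S.CausalStep ((chartAt (EuclideanSpace ℝ (Fin n)) x₀).symm y)
      ((chartAt (EuclideanSpace ℝ (Fin n)) x₀).symm z) := by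
  set e := chartAt (EuclideanSpace ℝ (Fin n)) x₀
  set l : ℝ → EuclideanSpace ℝ (Fin n) := fun t ↦ y + t • (z - y) with hl
  have hmem : ∀ t ∈ Icc (0 : ℝ) 1, l t ∈ segment ℝ y z := fun t ht ↦ by
    rw [segment_eq_image']; exact ⟨t, ht, rfl⟩
  have hls : ContMDiff 𝓘(ℝ, ℝ) (𝓡 n) ∞ l :=
    (contDiff_const.add (contDiff_id.smul contDiff_const)).contMDiff
  have he : ContMDiffOn (𝓡 n) (𝓡 n) ∞ e.symm e.target := contMDiffOn_chart_symm
  refine ⟨e.symm ∘ l, he.comp hls.contMDiffOn fun t ht ↦ hseg (hmem t ht), by simp [l], by simp [l],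
    fun t ht ↦ ?_⟩
  have hl' : HasMFDerivAt 𝓘(ℝ, ℝ) (𝓡 n) l t
      ((ContinuousLinearMap.id ℝ ℝ).smulRight (z - y)) := by
    have : HasFDerivAt l ((ContinuousLinearMap.id ℝ ℝ).smulRight (z - y)) t :=
      ((hasFDerivAt_id t).smul_const (z - y)).const_add y
    exact this.hasMFDerivAt
  have he' : MDifferentiableAt (𝓡 n) (𝓡 n) e.symm (l t) :=
    (he.contMDiffAt (e.open_target.mem_nhds (hseg (hmem t ht)))).mdifferentiableAt (by simp)
  have hd : mfderivWithin 𝓘(ℝ, ℝ) (𝓡 n) (e.symm ∘ l) (Icc 0 1) t (1 : ℝ) =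
      mfderiv (𝓡 n) (𝓡 n) e.symm (l t) (z - y) := by
    have h1 := (he'.hasMFDerivAt.comp t hl').hasMFDerivWithinAt (s := Icc 0 1)
    rw [h1.mfderivWithin (uniqueMDiffWithinAt_iff_uniqueDiffWithinAt.2
      (uniqueDiffOn_Icc zero_lt_one t ht))]
    change mfderiv (𝓡 n) (𝓡 n) e.symm (l t) ((1 : ℝ) • (z - y)) = _
    rw [one_smul]
  rw [hd]
  refine ⟨fun h0 ↦ ?_, hg _ (hmem t ht), hT _ (hmem t ht)⟩
  have := hT _ (hmem t ht)
  rw [chartTime, show mfderiv (𝓡 n) (𝓡 n) e.symm (l t) (z - y) = 0 from h0] at this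
  simp at this

/-- The points near `x₀` are connected by causal curves if their coordinate difference is
approximately a positive multiple of the time orientation. -/
theorem exists_causal_cone (x₀ : M) :
    ∃ (τ : EuclideanSpace ℝ (Fin n)) (r : ℝ), 0 < r ∧
      Metric.ball (chartAt (EuclideanSpace ℝ (Fin n)) x₀ x₀) r ⊆
        (chartAt (EuclideanSpace ℝ (Fin n)) x₀).target ∧
      ∀ y ∈ Metric.ball (chartAt (EuclideanSpace ℝ (Fin n)) x₀ x₀) r,
      ∀ z ∈ Metric.ball (chartAt (EuclideanSpace ℝ (Fin n)) x₀ x₀) r,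
      ∀ s : ℝ, 0 < s → ∀ v ∈ Metric.ball τ r, z - y = s • v →
        S.CausalStep ((chartAt (EuclideanSpace ℝ (Fin n)) x₀).symm y)
          ((chartAt (EuclideanSpace ℝ (Fin n)) x₀).symm z) := by
  set e := chartAt (EuclideanSpace ℝ (Fin n)) x₀
  have hx : e x₀ ∈ e.target := mem_chart_target _ _
  have hsymm : e.symm (e x₀) = x₀ := e.left_inv (mem_chart_source _ _)
  -- `τ` is the coordinate vector of `T` at `x₀`. Both causality conditions are strict at `(e x₀,
  -- τ)`, hence hold on a product of balls of one radius `r`; homogeneity in the vector then covers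
  -- all positive multiples.
  obtain ⟨τ, hτ⟩ : ∃ τ : EuclideanSpace ℝ (Fin n),
      mfderiv (𝓡 n) (𝓡 n) e.symm (e x₀) τ = S.T (e.symm (e x₀)) := by
    have hm := (mdifferentiable_chart (I := 𝓡 n) x₀)
    obtain ⟨τ, h⟩ := hm.symm.mfderiv_surjective (x := e x₀) hx (S.T (e.symm (e x₀)))
    exact ⟨τ, h⟩
  have hopen : IsOpen (e.target ×ˢ (univ : Set (EuclideanSpace ℝ (Fin n)))) :=
    e.open_target.prod isOpen_univ
  have h1 : ContinuousOn (fun p : EuclideanSpace ℝ (Fin n) × EuclideanSpace ℝ (Fin n) ↦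
      S.chartMetric x₀ p.1 p.2 p.2) (e.target ×ˢ univ) :=
    (S.continuousOn_chartMetric x₀).comp
      (f := fun p : EuclideanSpace ℝ (Fin n) × EuclideanSpace ℝ (Fin n) ↦ (p.1, p.2, p.2))
      (by fun_prop) fun _ hp ↦ ⟨hp.1, trivial⟩
  have e1 : ∀ᶠ p in 𝓝 (e x₀, τ), S.chartMetric x₀ p.1 p.2 p.2 < 0 := by
    refine (h1.continuousAt (hopen.mem_nhds ⟨hx, trivial⟩)).eventually_lt_const ?_
    change S.g (e.symm (e x₀)) _ _ < 0
    rw [hτ]; exact S.timelike_T _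
  have e2 : ∀ᶠ p in 𝓝 (e x₀, τ), S.chartTime x₀ p.1 p.2 < 0 := by
    refine ((S.continuousOn_chartTime x₀).continuousAt
      (hopen.mem_nhds ⟨hx, trivial⟩)).eventually_lt_const ?_
    change S.g (e.symm (e x₀)) _ _ < 0
    rw [hτ]; exact S.timelike_T _
  have e3 := hopen.mem_nhds (mk_mem_prod hx (mem_univ τ))
  obtain ⟨r, hr, hball⟩ := Metric.mem_nhds_iff.1 (inter_mem e3 (e1.and e2))
  rw [← ball_prod_same] at hball
  refine ⟨τ, r, hr, fun y hy ↦ (hball (mk_mem_prod hy (Metric.mem_ball_self hr))).1.1,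
    fun y hy z hz s hs v hv hzy ↦ S.causalStep_of_segment x₀ (fun p hp ↦ ?_) (fun p hp ↦ ?_)
      fun p hp ↦ ?_⟩ <;>
  have hp' := hball (mk_mem_prod ((convex_ball _ _).segment_subset hy hz hp) hv)
  · exact hp'.1.1
  · rw [hzy, chartMetric_smul]
    exact mul_nonpos_of_nonneg_of_nonpos (by positivity) hp'.2.1.le
  · rw [hzy, chartTime_smul]
    exact mul_neg_of_pos_of_neg hs hp'.2.2

/-- The point `p` lies a fixed small step `s` behind `x₀` along `τ`. As `x` tends to `x₀`, the
coordinate difference from `p` to `x`, divided by `s`, tends to `τ` and so enters the causal cone.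
-/
theorem exists_forall_causalStep_from (x₀ : M) : ∃ p, ∀ᶠ x in 𝓝 x₀, S.CausalStep p x := by
  obtain ⟨τ, r, hr, htgt, H⟩ := S.exists_causal_cone x₀
  set e := chartAt (EuclideanSpace ℝ (Fin n)) x₀
  obtain ⟨s, hs, hsr⟩ : ∃ s : ℝ, 0 < s ∧ e x₀ - s • τ ∈ Metric.ball (e x₀) r := by
    have h : ContinuousAt (fun s : ℝ ↦ e x₀ - s • τ) 0 := by fun_prop
    have h2 := h.eventually_mem (s := Metric.ball (e x₀) r) (by
      simpa using Metric.ball_mem_nhds _ hr)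
    obtain ⟨s, h3, h4⟩ := ((h2.filter_mono nhdsWithin_le_nhds).and
      (self_mem_nhdsWithin : Ioi (0 : ℝ) ∈ 𝓝[>] 0)).exists
    exact ⟨s, h4, h3⟩
  refine ⟨e.symm (e x₀ - s • τ), ?_⟩
  have hc : ContinuousAt e x₀ := e.continuousAt (mem_chart_source _ _)
  have h1 := hc.eventually_mem (Metric.ball_mem_nhds _ hr)
  have h2 : ∀ᶠ x in 𝓝 x₀, s⁻¹ • (e x - (e x₀ - s • τ)) ∈ Metric.ball τ r := by
    have : ContinuousAt (fun x ↦ s⁻¹ • (e x - (e x₀ - s • τ))) x₀ := by fun_prop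
    refine this.eventually_mem ?_
    simpa [smul_smul, hs.ne'] using Metric.ball_mem_nhds τ hr
  filter_upwards [h1, h2, e.open_source.mem_nhds (mem_chart_source _ x₀)] with x hx1 hx2 hx3
  have := H _ hsr _ hx1 s hs _ hx2 (by rw [smul_smul, mul_inv_cancel₀ hs.ne', one_smul])
  rwa [e.left_inv hx3] at this

theorem exists_forall_causalStep_to (x₀ : M) : ∃ q, ∀ᶠ x in 𝓝 x₀, S.CausalStep x q := by
  obtain ⟨τ, r, hr, htgt, H⟩ := S.exists_causal_cone x₀
  set e := chartAt (EuclideanSpace ℝ (Fin n)) x₀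
  obtain ⟨s, hs, hsr⟩ : ∃ s : ℝ, 0 < s ∧ e x₀ + s • τ ∈ Metric.ball (e x₀) r := by
    have h : ContinuousAt (fun s : ℝ ↦ e x₀ + s • τ) 0 := by fun_prop
    have h2 := h.eventually_mem (s := Metric.ball (e x₀) r) (by
      simpa using Metric.ball_mem_nhds _ hr)
    obtain ⟨s, h3, h4⟩ := ((h2.filter_mono nhdsWithin_le_nhds).and
      (self_mem_nhdsWithin : Ioi (0 : ℝ) ∈ 𝓝[>] 0)).exists
    exact ⟨s, h4, h3⟩
  refine ⟨e.symm (e x₀ + s • τ), ?_⟩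
  have hc : ContinuousAt e x₀ := e.continuousAt (mem_chart_source _ _)
  have h1 := hc.eventually_mem (Metric.ball_mem_nhds _ hr)
  have h2 : ∀ᶠ x in 𝓝 x₀, s⁻¹ • (e x₀ + s • τ - e x) ∈ Metric.ball τ r := by
    have : ContinuousAt (fun x ↦ s⁻¹ • (e x₀ + s • τ - e x)) x₀ := by fun_prop
    refine this.eventually_mem ?_
    simpa [smul_smul, hs.ne'] using Metric.ball_mem_nhds τ hr
  filter_upwards [h1, h2, e.open_source.mem_nhds (mem_chart_source _ x₀)] with x hx1 hx2 hx3
  have := H _ hx1 _ hsr s hs _ hx2 (by rw [smul_smul, mul_inv_cancel₀ hs.ne', one_smul])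
  rwa [e.left_inv hx3] at this

end TimeOrientedLorentzMetric

/-- The volume measure of a Lorentzian metric is finite on compact sets. -/
theorem IsVolumeMeasure.isFiniteMeasureOnCompacts [MeasurableSpace M] [BorelSpace M]
    (S : TimeOrientedLorentzMetric n M) {μ : Measure M}
    (hμ : IsVolumeMeasure (fun x v w ↦ S.g x v w) μ) : IsFiniteMeasureOnCompacts μ := by
  suffices IsLocallyFiniteMeasure μ by infer_instance
  refine ⟨fun x₀ ↦ ?_⟩
  set e := chartAt (EuclideanSpace ℝ (Fin n)) x₀ with he
  have hx : e x₀ ∈ e.target := mem_chart_target _ _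
  have hc : ContinuousAt (fun y ↦ volumeDensity (fun x v w ↦ S.g x v w) e y) (e x₀) := by
    have hij : ∀ v w, ContinuousAt (fun y ↦ S.chartMetric x₀ y v w) (e x₀) := fun v w ↦
      ((S.continuousOn_chartMetric x₀).comp (s := e.target)
        (f := fun y : EuclideanSpace ℝ (Fin n) ↦ (y, v, w)) (by fun_prop)
        fun _ hp ↦ ⟨hp, trivial⟩).continuousAt (e.open_target.mem_nhds hx)
    unfold volumeDensity
    refine Real.continuous_sqrt.continuousAt.comp (continuous_abs.continuousAt.comp ?_)
    refine (continuous_id.matrix_det (A := fun A : Matrix (Fin n) (Fin n) ℝ ↦ A)).continuousAt.comp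
      (f := fun y ↦ Matrix.of fun i j : Fin n ↦ S.chartMetric x₀ y
        (EuclideanSpace.single i (1 : ℝ)) (EuclideanSpace.single j (1 : ℝ))) ?_
    exact continuousAt_pi.2 fun i ↦ continuousAt_pi.2 fun j ↦ hij _ _
  -- By continuity the density stays below `C` on a small ball, so the measure of the corresponding
  -- neighbourhood is at most `C` times the Lebesgue measure of the ball.
  set C := volumeDensity (fun x v w ↦ S.g x v w) e (e x₀) + 1
  obtain ⟨r, hr, hball⟩ := Metric.mem_nhds_iff.1 (inter_mem (e.open_target.mem_nhds hx)
    (hc.eventually_lt_const (lt_add_one _)))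
  set A := e.source ∩ e ⁻¹' Metric.ball (e x₀) r
  have hA : IsOpen A := e.isOpen_inter_preimage Metric.isOpen_ball
  refine ⟨A, hA.mem_nhds ⟨mem_chart_source _ _, Metric.mem_ball_self hr⟩, ?_⟩
  rw [hμ e (IsManifold.chart_mem_maximalAtlas x₀) A hA.measurableSet inter_subset_left]
  have him : e '' A ⊆ Metric.ball (e x₀) r := image_subset_iff.2 inter_subset_right
  calc ∫⁻ y in e '' A, ENNReal.ofReal (volumeDensity (fun x v w ↦ S.g x v w) e y)
      ≤ ∫⁻ y in Metric.ball (e x₀) r,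
          ENNReal.ofReal (volumeDensity (fun x v w ↦ S.g x v w) e y) := lintegral_mono_set him
    _ ≤ ∫⁻ _ in Metric.ball (e x₀) r, ENNReal.ofReal C :=
        setLIntegral_mono measurable_const fun y hy ↦ ENNReal.ofReal_le_ofReal (hball hy).2.le
    _ < ⊤ := by
        rw [setLIntegral_const]
        exact ENNReal.mul_lt_top ENNReal.ofReal_lt_top measure_ball_lt_top

end ChartGeometry

/-! ### Compactness and closedness from causal diamonds -/

section CausalRelation

/-- The properties of the causal relation of a globally hyperbolic spacetime that are used to solve
hyperbolic equations. They are invariant under time reversal. -/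
structure IsCausalRelation {M : Type*} [TopologicalSpace M] (R : M → M → Prop) : Prop where
  refl : ∀ x, R x x
  trans : ∀ {x y z}, R x y → R y z → R x z
  isCompact_diamond : ∀ p q, IsCompact {x | R p x ∧ R x q}
  exists_past : ∀ x, ∃ p, ∀ᶠ y in 𝓝 x, R p y
  exists_future : ∀ x, ∃ q, ∀ᶠ y in 𝓝 x, R y q

/-- The points that are related to some point of `K`. -/
def relImage {M : Type*} (R : M → M → Prop) (K : Set M) : Set M := {q | ∃ p ∈ K, R p q}

theorem relImage_mono {M : Type*} {R : M → M → Prop} {K K' : Set M} (h : K ⊆ K') :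
    relImage R K ⊆ relImage R K' := fun _ ⟨p, hp, hR⟩ ↦ ⟨p, h hp, hR⟩

namespace IsCausalRelation

variable {M : Type*} [TopologicalSpace M] {R : M → M → Prop}

/-- Time reversal. `J⁺` and `J⁻` are the images under `R` and its reverse, so each statement about
retarded propagators and bounded past also gives the one about advanced propagators and bounded
future. -/
theorem swap (hR : IsCausalRelation R) : IsCausalRelation (Function.swap R) where
  refl := hR.refl
  trans h h' := hR.trans h' h
  isCompact_diamond p q := by
    simpa only [Function.swap, and_comm] using hR.isCompact_diamond q p
  exists_past := hR.exists_future
  exists_future := hR.exists_past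

/-- A limit point `x` of the future of `p` has a neighbourhood in the past of some `q`, so it is a
limit point of the diamond between `p` and `q`, which is compact and therefore closed. -/
theorem isClosed_relImage [T2Space M] (hR : IsCausalRelation R) {F : Set M} (hF : F.Finite) :
    IsClosed (relImage R F) := by
  have h1 : ∀ p, IsClosed {x | R p x} := fun p ↦ by
    refine isClosed_of_closure_subset fun x hx ↦ ?_
    obtain ⟨q, hq⟩ := hR.exists_future x
    have h2 : x ∈ closure {x | R p x ∧ R x q} := by
      rw [mem_closure_iff_frequently] at hx ⊢
      exact (hx.and_eventually hq).mono fun y hy ↦ hy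
    rw [(hR.isCompact_diamond p q).isClosed.closure_eq] at h2
    exact h2.1
  have h2 : relImage R F = ⋃ p ∈ F, {x | R p x} := by ext; simp [relImage]
  rw [h2]
  exact hF.isClosed_biUnion fun p _ ↦ h1 p

theorem isCompact_relImage_inter (hR : IsCausalRelation R) {F F' : Set M} (hF : F.Finite)
    (hF' : F'.Finite) : IsCompact (relImage R F ∩ relImage (Function.swap R) F') := by
  have h : relImage R F ∩ relImage (Function.swap R) F' =
      ⋃ p ∈ F, ⋃ q ∈ F', {x | R p x ∧ R x q} := by
    ext x; simp [relImage, Function.swap]; grind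
  rw [h]
  exact hF.isCompact_biUnion fun p _ ↦ hF'.isCompact_biUnion fun q _ ↦ hR.isCompact_diamond p q

/-- Allows compact sets to be replaced by finite ones: intersections of futures and pasts then
become finite unions of diamonds. -/
theorem exists_finite_past (hR : IsCausalRelation R) {K : Set M} (hK : IsCompact K) :
    ∃ F : Set M, F.Finite ∧ K ⊆ relImage R F := by
  choose p hp using hR.exists_past
  obtain ⟨t, -, ht⟩ := hK.elim_nhds_subcover (fun x ↦ {y | R (p x) y}) fun x _ ↦ hp x
  refine ⟨p '' t, t.finite_toSet.image _, fun x hx ↦ ?_⟩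
  obtain ⟨y, hy, hxy⟩ := mem_iUnion₂.1 (ht hx)
  exact ⟨p y, mem_image_of_mem _ hy, hxy⟩

theorem relImage_subset (hR : IsCausalRelation R) {K F : Set M} (h : K ⊆ relImage R F) :
    relImage R K ⊆ relImage R F := fun _ ⟨_, hp, hR'⟩ ↦
  let ⟨q, hq, hqp⟩ := h hp
  ⟨q, hq, hR.trans hqp hR'⟩

end IsCausalRelation

theorem TimeOrientedLorentzMetric.IsGloballyHyperbolic.isCausalRelation {n : ℕ} {M : Type*}
    [TopologicalSpace M] [ChartedSpace (EuclideanSpace ℝ (Fin n)) M] [IsManifold (𝓡 n) ∞ M]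
    {S : TimeOrientedLorentzMetric n M} (hS : S.IsGloballyHyperbolic) :
    IsCausalRelation (Relation.ReflTransGen S.CausalStep) where
  refl _ := .refl
  trans h h' := h.trans h'
  isCompact_diamond p q := by
    have h := hS.2 p q
    simp only [JPlus, JMinus, mem_singleton_iff, exists_eq_left] at h
    exact h
  exists_past x := (S.exists_forall_causalStep_from x).imp fun _ h ↦ h.mono fun _ ↦ .single
  exists_future x := (S.exists_forall_causalStep_to x).imp fun _ h ↦ h.mono fun _ ↦ .single

end CausalRelation

/-! ### Cutoffs, locality of differential operators, ghost projections -/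

section SectionLemmas

variable {n : ℕ} {M : Type*} [TopologicalSpace M] [ChartedSpace (EuclideanSpace ℝ (Fin n)) M]
  {F : Type*} [NormedAddCommGroup F] [NormedSpace ℂ F]
  {V : M → Type*} [∀ x, AddCommGroup (V x)] [∀ x, Module ℂ (V x)] [∀ x, TopologicalSpace (V x)]
  [TopologicalSpace (TotalSpace F V)] [FiberBundle F V]
  [VectorBundle ℂ F V] [VectorBundle ℝ F V]

theorem notMem_secSupport {u : SmoothSections n F V} {x : M} :
    x ∉ secSupport u ↔ ∀ᶠ y in 𝓝 x, u.1 y = 0 := by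
  rw [secSupport, mem_closure_iff_frequently, not_frequently]
  simp only [mem_ofPred_eq, not_not]

theorem eq_zero_of_notMem_secSupport {u : SmoothSections n F V} {x : M} (h : x ∉ secSupport u) :
    u.1 x = 0 := (notMem_secSupport.1 h).self_of_nhds

theorem fsmul_apply (f : C^∞⟮𝓡 n, M; 𝓘(ℝ, ℝ), ℝ⟯) (u : SmoothSections n F V) (x : M) :
    (fsmul f u).1 x = (f x : ℂ) • u.1 x := rfl

theorem secSupport_fsmul (f : C^∞⟮𝓡 n, M; 𝓘(ℝ, ℝ), ℝ⟯) (u : SmoothSections n F V) :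
    secSupport (fsmul f u) ⊆ secSupport u :=
  closure_mono fun x hx h ↦ hx (by simp [fsmul_apply, h])

theorem fsmul_mem_compactSections {f : C^∞⟮𝓡 n, M; 𝓘(ℝ, ℝ), ℝ⟯} (hf : HasCompactSupport f)
    (u : SmoothSections n F V) : fsmul f u ∈ CompactSections n F V :=
  hf.of_isClosed_subset isClosed_closure <| closure_mono fun x hx h ↦ hx (by simp [fsmul_apply, h])

section Cutoff

variable [T2Space M] [SecondCountableTopology M] [IsManifold (𝓡 n) ∞ M]

theorem exists_separating_function {s t : Set M} (hs : IsClosed s) (ht : IsClosed t)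
    (hd : Disjoint s t) : ∃ f : C^∞⟮𝓡 n, M; 𝓘(ℝ, ℝ), ℝ⟯,
      (∀ᶠ x in 𝓝ˢ s, f x = 0) ∧ ∀ᶠ x in 𝓝ˢ t, f x = 1 := by
  have : LocallyCompactSpace M := Manifold.locallyCompact_of_finiteDimensional (𝓡 n)
  obtain ⟨f, h0, h1, -⟩ := exists_contMDiffMap_zero_one_nhds_of_isClosed (𝓡 n) hs ht hd (n := ⊤)
  exact ⟨f, h0, h1⟩

theorem exists_compact_cutoff {K : Set M} (hK : IsCompact K) :
    ∃ f : C^∞⟮𝓡 n, M; 𝓘(ℝ, ℝ), ℝ⟯, HasCompactSupport f ∧ ∀ᶠ x in 𝓝ˢ K, f x = 1 := by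
  have : LocallyCompactSpace M := Manifold.locallyCompact_of_finiteDimensional (𝓡 n)
  obtain ⟨K', hK', hKK'⟩ := exists_compact_superset hK
  obtain ⟨f, h0, h1⟩ := exists_separating_function (n := n) isOpen_interior.isClosed_compl
    hK.isClosed (disjoint_left.2 fun x hx hx' ↦ hx (hKK' hx'))
  refine ⟨f, HasCompactSupport.intro hK' fun x hx ↦ ?_, h1⟩
  exact h0.self_of_nhdsSet _ fun h ↦ hx (interior_subset h)

/-- Applied with `p y` the condition `u y = 0`: then `f u = u` although `f x = 0`, which is what
forces locality. -/
theorem exists_function_zero_near_one {x : M} {p : M → Prop} (hp : ∀ᶠ y in 𝓝 x, p y) :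
    ∃ f : C^∞⟮𝓡 n, M; 𝓘(ℝ, ℝ), ℝ⟯, f x = 0 ∧ ∀ y, ¬ p y → f y = 1 := by
  obtain ⟨U, hU, hUo, hxU⟩ := eventually_nhds_iff.1 hp
  obtain ⟨f, h0, h1⟩ := exists_separating_function (n := n) (isClosed_singleton (x := x))
    hUo.isClosed_compl (disjoint_left.2 fun y hy hy' ↦ hy' (by rwa [mem_singleton_iff.1 hy]))
  exact ⟨f, h0.self_of_nhdsSet _ rfl, fun y hy ↦ h1.self_of_nhdsSet _ fun h ↦ hy (hU y h)⟩

/-- Differential operators are local. -/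
theorem IsDiffOpOfOrder.apply_eq_zero {N : Type*} {W : N → Type*} [∀ y, AddCommGroup (W y)]
    [∀ y, Module ℂ (W y)] {ι : N → M} {m : ℕ} {D : SmoothSections n F V → ∀ y, W y}
    (hD : IsDiffOpOfOrder ι m D) {u : SmoothSections n F V} {y : N}
    (hu : ∀ᶠ x in 𝓝 (ι y), u.1 x = 0) : D u y = 0 := by
  obtain ⟨f, hf0, hf1⟩ := exists_function_zero_near_one (n := n) hu
  have hfu : fsmul f u = u := by
    refine Subtype.ext (funext fun x ↦ ?_)
    rw [fsmul_apply]
    by_cases hx : u.1 x = 0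
    · rw [hx, smul_zero]
    · rw [hf1 x hx, Complex.ofReal_one, one_smul]
  -- Since `f u = u` and `f (ι y) = 0`, the commutator of `D` with `f` takes the same value at `u`
  -- and `y` as `D` itself but has smaller order; in order 0 the value is `f (ι y) • D u y = 0`.
  induction m generalizing D with
  | zero =>
    have h := hD f u y
    rwa [hfu, hf0, Complex.ofReal_zero, zero_smul] at h
  | succ m ih =>
    have h := ih (hD f)
    rwa [hfu, hf0, Complex.ofReal_zero, zero_smul, sub_zero] at h

end Cutoff

/-- `A` does not enlarge supports. -/
def IsLocalOp (A : SmoothSections n F V →ₗ[ℂ] SmoothSections n F V) : Prop :=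
  ∀ u x, (∀ᶠ y in 𝓝 x, u.1 y = 0) → (A u).1 x = 0

theorem IsDiffOp.isLocalOp [T2Space M] [SecondCountableTopology M] [IsManifold (𝓡 n) ∞ M]
    {A : SmoothSections n F V →ₗ[ℂ] SmoothSections n F V} (hA : IsDiffOp A) : IsLocalOp A :=
  fun _ _ hu ↦ hA.choose_spec.apply_eq_zero hu

namespace IsLocalOp

variable {A : SmoothSections n F V →ₗ[ℂ] SmoothSections n F V}

theorem secSupport_subset (hA : IsLocalOp A) (u : SmoothSections n F V) :
    secSupport (A u) ⊆ secSupport u := fun x hx ↦ by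
  by_contra h
  exact notMem_secSupport.2
    ((notMem_secSupport.1 h).eventually_nhds.mono fun y hy ↦ hA u y hy) hx

theorem congr (hA : IsLocalOp A) {u v : SmoothSections n F V} {x : M}
    (h : ∀ᶠ y in 𝓝 x, u.1 y = v.1 y) : (A u).1 x = (A v).1 x := by
  rw [← sub_eq_zero]
  have := hA (u - v) x (h.mono fun y hy ↦ by simp [hy])
  simpa [map_sub] using this

theorem mem_compactSections (hA : IsLocalOp A) {u : SmoothSections n F V}
    (hu : u ∈ CompactSections n F V) : A u ∈ CompactSections n F V :=
  IsCompact.of_isClosed_subset hu isClosed_closure (hA.secSupport_subset u)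

theorem mem_spaceCompactSections [IsManifold (𝓡 n) ∞ M] {S : TimeOrientedLorentzMetric n M}
    (hA : IsLocalOp A) {u : SmoothSections n F V} (hu : u ∈ SpaceCompactSections F V S) :
    A u ∈ SpaceCompactSections F V S :=
  let ⟨K, hK, h⟩ := hu
  ⟨K, hK, (hA.secSupport_subset u).trans h⟩

end IsLocalOp

namespace GhostGrading

variable (P : GhostGrading n F V)

/-- The projection of sections onto ghost number `i`. -/
def project (i : ℤ) : SmoothSections n F V →ₗ[ℂ] SmoothSections n F V where
  toFun u := ⟨fun x ↦ P.proj i x (u.1 x), P.smooth i u⟩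
  map_add' u v := Subtype.ext <| funext fun x ↦ by simp
  map_smul' a u := Subtype.ext <| funext fun x ↦ by simp

theorem isLocalOp_project (i : ℤ) : IsLocalOp (P.project i) := fun u x hu ↦ by
  simp [project, hu.self_of_nhds]

theorem mem_degree_iff {i : ℤ} {u : SmoothSections n F V} :
    u ∈ P.degree i ↔ P.project i u = u := by
  rw [Subtype.ext_iff, funext_iff]; rfl

theorem project_project (i j : ℤ) (u : SmoothSections n F V) :
    P.project i (P.project j u) = if i = j then P.project j u else 0 := by
  refine Subtype.ext (funext fun x ↦ ?_)
  have := P.proj_proj i j x (u.1 x)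
  split_ifs with h <;> simpa [project, h] using this

theorem project_mem_degree (i : ℤ) (u : SmoothSections n F V) : P.project i u ∈ P.degree i := by
  rw [mem_degree_iff, project_project, if_pos rfl]

theorem project_of_mem_degree {i j : ℤ} {u : SmoothSections n F V} (hu : u ∈ P.degree j) :
    P.project i u = if i = j then u else 0 := by
  rw [mem_degree_iff] at hu
  rw [← hu, project_project]

theorem sum_project (u : SmoothSections n F V) :
    P.project (-1) u + P.project 0 u + P.project 1 u = u :=
  Subtype.ext <| funext fun x ↦ P.sum_proj x (u.1 x)

theorem project_eq_zero {i : ℤ} (h : i ≠ -1) (h0 : i ≠ 0) (h1 : i ≠ 1) (u : SmoothSections n F V) :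
    P.project i u = 0 := Subtype.ext <| funext fun x ↦ P.proj_eq_zero i x (u.1 x) h h0 h1

end GhostGrading

end SectionLemmas

/-! ### Graded operators and projections -/

section ProjectCommute

variable {n : ℕ} {M : Type*} [TopologicalSpace M] [ChartedSpace (EuclideanSpace ℝ (Fin n)) M]
  {F : Type*} [NormedAddCommGroup F] [NormedSpace ℂ F]
  {V : M → Type*} [∀ x, AddCommGroup (V x)] [∀ x, Module ℂ (V x)] [∀ x, TopologicalSpace (V x)]
  [TopologicalSpace (TotalSpace F V)] [FiberBundle F V]
  [VectorBundle ℂ F V] [VectorBundle ℝ F V]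
  {n' : ℕ} {M' : Type*} [TopologicalSpace M'] [ChartedSpace (EuclideanSpace ℝ (Fin n')) M']
  {F' : Type*} [NormedAddCommGroup F'] [NormedSpace ℂ F']
  {V' : M' → Type*} [∀ x, AddCommGroup (V' x)] [∀ x, Module ℂ (V' x)]
  [∀ x, TopologicalSpace (V' x)] [TopologicalSpace (TotalSpace F' V')] [FiberBundle F' V']
  [VectorBundle ℂ F' V'] [VectorBundle ℝ F' V']

/-- An operator that maps degree `i` to degree `σ i` intertwines the projections. -/
theorem GhostGrading.map_project (P : GhostGrading n F V) (P' : GhostGrading n' F' V')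
    {A : SmoothSections n F V →ₗ[ℂ] SmoothSections n' F' V'} {σ : ℤ → ℤ}
    (hσ : Function.Injective σ) (hA : ∀ i, ∀ u ∈ P.degree i, A u ∈ P'.degree (σ i)) (i : ℤ)
    (u : SmoothSections n F V) : A (P.project i u) = P'.project (σ i) (A u) := by
  -- Injectivity of `σ` keeps images of different degrees apart. The shifts needed are `i ↦ -i` for
  -- `L`, `i ↦ i - 1` for `γ` and the identity for `ρ`.
  have h : ∀ j, P'.project (σ i) (A (P.project j u)) = if i = j then A (P.project j u) else 0 :=
    fun j ↦ by
      rw [P'.project_of_mem_degree (hA j _ (P.project_mem_degree j u))]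
      simp only [hσ.eq_iff]
  conv_rhs => rw [← P.sum_project u]
  simp only [map_add, h]
  by_cases h1 : i = -1
  · simp [h1]
  by_cases h2 : i = 0
  · simp [h2]
  by_cases h3 : i = 1
  · simp [h3]
  simp [h1, h2, h3, P.project_eq_zero h1 h2 h3]

end ProjectCommute

/-! ### The pairing and formal adjoints -/

section Pairing

variable {n : ℕ} {M : Type*} [TopologicalSpace M] [ChartedSpace (EuclideanSpace ℝ (Fin n)) M]
  {F : Type*} [NormedAddCommGroup F] [NormedSpace ℂ F]
  {V : M → Type*} [∀ x, AddCommGroup (V x)] [∀ x, Module ℂ (V x)] [∀ x, TopologicalSpace (V x)]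
  [TopologicalSpace (TotalSpace F V)] [FiberBundle F V]
  [VectorBundle ℂ F V] [VectorBundle ℝ F V]
  [MeasurableSpace M]

namespace HermitianStructure

variable (h : HermitianStructure n F V) (μ : Measure M)

theorem integrable_form [BorelSpace M] [IsFiniteMeasureOnCompacts μ] {u : SmoothSections n F V} (hu : u ∈ CompactSections n F V)
    (v : SmoothSections n F V) : Integrable (fun x ↦ h.form x (u.1 x) (v.1 x)) μ :=
  (h.smooth u v).continuous.integrable_of_hasCompactSupport <|
    IsCompact.of_isClosed_subset hu isClosed_closure <| closure_mono fun x hx h0 ↦ hx (by simp [h0])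

/-- The pairing of compactly supported sections with smooth sections. -/
def compactPairing [BorelSpace M] [IsFiniteMeasureOnCompacts μ] :
    CompactSections n F V →ₗ⋆[ℂ] SmoothSections n F V →ₗ[ℂ] ℂ :=
  LinearMap.mk₂'ₛₗ _ _ (fun u v ↦ h.pairing μ u v)
    (fun u u' v ↦ by
      simp only [pairing, Submodule.coe_add, Pi.add_apply, map_add, LinearMap.add_apply]
      exact integral_add (h.integrable_form μ u.2 v) (h.integrable_form μ u'.2 v))
    (fun a u v ↦ by
      simp only [pairing, Submodule.coe_smul, Pi.smul_apply, LinearMap.map_smulₛₗ,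
        LinearMap.smul_apply]
      exact integral_smul _ _)
    (fun u v v' ↦ by
      simp only [pairing, Submodule.coe_add, Pi.add_apply, map_add]
      exact integral_add (h.integrable_form μ u.2 v) (h.integrable_form μ u.2 v'))
    (fun a u v ↦ by
      simp only [pairing, Submodule.coe_smul, Pi.smul_apply, LinearMap.map_smulₛₗ]
      exact integral_smul _ _)

theorem compactPairing_apply [BorelSpace M] [IsFiniteMeasureOnCompacts μ]
    (u : CompactSections n F V) (v : SmoothSections n F V) :
    h.compactPairing μ u v = h.pairing μ u v := rfl

theorem pairing_congr_right {u v v' : SmoothSections n F V}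
    (hv : ∀ x ∈ secSupport u, v.1 x = v'.1 x) : h.pairing μ u v = h.pairing μ u v' := by
  refine integral_congr_ae (Eventually.of_forall fun x ↦ ?_)
  by_cases hx : x ∈ secSupport u
  · simp [hv x hx]
  · simp [eq_zero_of_notMem_secSupport hx]

end HermitianStructure

/-- Formal adjointness extends to pairs of sections only one of which has compact support. -/
theorem IsFormalAdjoint.pairing_eq [T2Space M] [SecondCountableTopology M] [IsManifold (𝓡 n) ∞ M]
    {h : HermitianStructure n F V} {μ : Measure M}
    {A B : SmoothSections n F V →ₗ[ℂ] SmoothSections n F V} (hAB : IsFormalAdjoint h μ A B)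
    (hA : IsLocalOp A) (hB : IsLocalOp B) {u : SmoothSections n F V}
    (hu : u ∈ CompactSections n F V) (v : SmoothSections n F V) :
    h.pairing μ (B u) v = h.pairing μ u (A v) := by
  -- As `f = 1` near the support of `u`, replacing `v` by the compactly supported `f v` changes
  -- neither pairing, by locality of `A` and `B`.
  obtain ⟨f, hf, hf1⟩ := exists_compact_cutoff (n := n) (show IsCompact (secSupport u) from hu)
  have hnear : ∀ x ∈ secSupport u, ∀ᶠ y in 𝓝 x, (fsmul f v).1 y = v.1 y := fun x hx ↦
    ((eventually_nhdsSet_iff_forall.1 hf1) x hx).mono fun y hy ↦ by simp [fsmul_apply, hy]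
  calc h.pairing μ (B u) v = h.pairing μ (B u) (fsmul f v) :=
        h.pairing_congr_right μ fun x hx ↦
          (hnear x (hB.secSupport_subset u hx)).self_of_nhds.symm
    _ = h.pairing μ u (A (fsmul f v)) := hAB u hu _ (fsmul_mem_compactSections hf v)
    _ = h.pairing μ u (A v) := h.pairing_congr_right μ fun x hx ↦ hA.congr (hnear x hx)

end Pairing

/-! ### Uniqueness of solutions with bounded past -/

section Propagators

variable {n : ℕ} {M : Type*} [TopologicalSpace M] [ChartedSpace (EuclideanSpace ℝ (Fin n)) M]
  {F : Type*} [NormedAddCommGroup F] [NormedSpace ℂ F]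
  {V : M → Type*} [∀ x, AddCommGroup (V x)] [∀ x, Module ℂ (V x)] [∀ x, TopologicalSpace (V x)]
  [TopologicalSpace (TotalSpace F V)] [FiberBundle F V]
  [VectorBundle ℂ F V] [VectorBundle ℝ F V]

/-- A section has bounded past (with respect to the causal relation `R`) if it is supported in the
image under `R` of a finite set. -/
def HasBoundedPast (R : M → M → Prop) (u : SmoothSections n F V) : Prop :=
  ∃ F : Set M, F.Finite ∧ secSupport u ⊆ relImage R F

variable {R : M → M → Prop} {L : SmoothSections n F V →ₗ[ℂ] SmoothSections n F V}
  {G : CompactSections n F V →ₗ[ℂ] SmoothSections n F V}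

theorem HasBoundedPast.sub {u v : SmoothSections n F V} (hu : HasBoundedPast R u)
    (hv : HasBoundedPast R v) : HasBoundedPast R (u - v) := by
  obtain ⟨F₁, hF₁, h₁⟩ := hu
  obtain ⟨F₂, hF₂, h₂⟩ := hv
  refine ⟨F₁ ∪ F₂, hF₁.union hF₂, ?_⟩
  rw [sub_eq_add_neg, ← neg_one_smul ℂ v]
  exact (secSupport_add _ _).trans (union_subset (h₁.trans (relImage_mono subset_union_left))
    (((secSupport_smul _ _).trans h₂).trans (relImage_mono subset_union_right)))

theorem IsLocalOp.hasBoundedPast (hL : IsLocalOp L) {u : SmoothSections n F V}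
    (hu : HasBoundedPast R u) : HasBoundedPast R (L u) :=
  let ⟨F₁, hF₁, h₁⟩ := hu
  ⟨F₁, hF₁, (hL.secSupport_subset u).trans h₁⟩

namespace IsPropagator

theorem hasBoundedPast (hR : IsCausalRelation R) (hG : IsPropagator (relImage R) L G)
    (u : CompactSections n F V) : HasBoundedPast R (G u) := by
  obtain ⟨F₁, hF₁, h₁⟩ := hR.exists_finite_past u.2
  exact ⟨F₁, hF₁, (hG.support u).trans (hR.relImage_subset h₁)⟩

variable [T2Space M] [SecondCountableTopology M] [IsManifold (𝓡 n) ∞ M]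

/-- Solutions of `L g = 0` with bounded past vanish. -/
theorem eq_zero_of_hasBoundedPast (hR : IsCausalRelation R) (hL : IsLocalOp L)
    (hG : IsPropagator (relImage R) L G) {g : SmoothSections n F V} (hg : HasBoundedPast R g)
    (hLg : L g = 0) : g = 0 := by
  obtain ⟨F₁, hF₁, h₁⟩ := hg
  refine Subtype.ext (funext fun x ↦ ?_)
  by_contra hx
  have hxg : x ∈ secSupport g := by
    by_contra h
    exact hx (eq_zero_of_notMem_secSupport h)
  -- Cut off near the compact set between `F₁` and `x`. Then `f g = G (L (f g))`, so `x` is in the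
  -- future of some `p` in the support of `L (f g)`. Such a `p` lies in this compact set, near which
  -- `f = 1` and so `L (f g) = L g = 0`: a contradiction.
  obtain ⟨f, hf, hf1⟩ := exists_compact_cutoff (n := n)
    (hR.isCompact_relImage_inter hF₁ (finite_singleton x))
  replace hf1 := eventually_nhdsSet_iff_forall.1 hf1
  have hfg := fsmul_mem_compactSections hf g
  have hx' : x ∈ secSupport (fsmul f g) := by
    by_contra h
    have hfx := (hf1 x ⟨h₁ hxg, x, rfl, hR.refl x⟩).self_of_nhds
    exact hx (by simpa [fsmul_apply, hfx] using eq_zero_of_notMem_secSupport h)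
  have hGL : G ⟨_, hL.mem_compactSections hfg⟩ = fsmul f g := hG.left_inv ⟨_, hfg⟩ _ rfl
  rw [← hGL] at hx'
  obtain ⟨p, hp, hpx⟩ := hG.support _ hx'
  have hpF : p ∈ relImage R F₁ := h₁ (secSupport_fsmul f g (hL.secSupport_subset _ hp))
  refine notMem_secSupport.2 ?_ hp
  filter_upwards [(hf1 p ⟨hpF, x, rfl, hpx⟩).eventually_nhds] with y hy
  rw [hL.congr (v := g) (hy.mono fun z hz ↦ by simp [fsmul_apply, hz]), hLg]
  rfl

/-- The solution of `L g = w` with bounded past is unique. -/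
theorem eq_apply (hR : IsCausalRelation R) (hL : IsLocalOp L)
    (hG : IsPropagator (relImage R) L G) {g : SmoothSections n F V} (hg : HasBoundedPast R g)
    (w : CompactSections n F V) (hLg : L g = w) : g = G w := by
  rw [← sub_eq_zero]
  refine hG.eq_zero_of_hasBoundedPast hR hL (hg.sub (hG.hasBoundedPast hR w)) ?_
  rw [map_sub, hLg, hG.right_inv, sub_self]

/-- If `A L = L B`, then `B G = G A`. -/
theorem comm (hR : IsCausalRelation R) (hL : IsLocalOp L)
    (hG : IsPropagator (relImage R) L G) {A B : SmoothSections n F V →ₗ[ℂ] SmoothSections n F V}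
    (hB : IsLocalOp B) (hAB : ∀ u, A (L u) = L (B u)) (u w : CompactSections n F V)
    (hw : (w : SmoothSections n F V) = A u) : B (G u) = G w := by
  refine hG.eq_apply hR hL (hB.hasBoundedPast (hG.hasBoundedPast hR u)) w ?_
  rw [← hAB, hG.right_inv, hw]

end IsPropagator

end Propagators

/-! ### Splitting space-compact sections -/

section CausalPropagator

variable {n : ℕ} {M : Type*} [TopologicalSpace M] [ChartedSpace (EuclideanSpace ℝ (Fin n)) M]
  {F : Type*} [NormedAddCommGroup F] [NormedSpace ℂ F]
  {V : M → Type*} [∀ x, AddCommGroup (V x)] [∀ x, Module ℂ (V x)] [∀ x, TopologicalSpace (V x)]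
  [TopologicalSpace (TotalSpace F V)] [FiberBundle F V]
  [VectorBundle ℂ F V] [VectorBundle ℝ F V]
  [T2Space M] [SecondCountableTopology M] [IsManifold (𝓡 n) ∞ M]

/-- A space-compact section is the sum of a section with bounded past and one with bounded
future. -/
theorem exists_past_future_decomposition {S : TimeOrientedLorentzMetric n M}
    (hS : S.IsGloballyHyperbolic)
    {f : SmoothSections n F V} (hf : f ∈ SpaceCompactSections F V S) :
    ∃ g : SmoothSections n F V, HasBoundedPast (Relation.ReflTransGen S.CausalStep) g ∧
      HasBoundedPast (Function.swap (Relation.ReflTransGen S.CausalStep)) (f - g) := by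
  have hR := hS.isCausalRelation
  set R := Relation.ReflTransGen S.CausalStep
  have : LocallyCompactSpace M := Manifold.locallyCompact_of_finiteDimensional (𝓡 n)
  obtain ⟨K, hK, hfK⟩ := hf
  obtain ⟨F₁, hF₁, h₁⟩ := hR.exists_finite_past hK
  obtain ⟨F₂, hF₂, h₂⟩ := hR.swap.exists_finite_past hK
  have hfF : secSupport f ⊆ relImage R F₁ ∪ relImage (Function.swap R) F₂ :=
    hfK.trans (union_subset_union (hR.relImage_subset h₁) (hR.swap.relImage_subset h₂))
  obtain ⟨K', hK', hKK'⟩ := exists_compact_superset (hR.isCompact_relImage_inter hF₁ hF₂)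
  obtain ⟨F₃, hF₃, h₃⟩ := hR.exists_finite_past hK'
  obtain ⟨F₄, hF₄, h₄⟩ := hR.swap.exists_finite_past hK'
  -- The future of `F₁` and the past of `F₂` meet only inside the interior of `K'`, so outside it
  -- they are disjoint closed sets. There `χ` is 1 near the future and 0 near the past; inside `K'`
  -- its values do not matter, since `K'` has finite past and future covers `F₃` and `F₄`.
  obtain ⟨χ, hχ0, hχ1⟩ := exists_separating_function (n := n)
    ((hR.swap.isClosed_relImage hF₂).sdiff (isOpen_interior (s := K')))
    ((hR.isClosed_relImage hF₁).sdiff (isOpen_interior (s := K')))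
    (disjoint_left.2 fun x hx hx' ↦ hx.2 (hKK' ⟨hx'.1, hx.1⟩))
  rw [eventually_nhdsSet_iff_forall] at hχ0 hχ1
  refine ⟨fsmul χ f, ⟨F₁ ∪ F₃, hF₁.union hF₃, fun x hx ↦ ?_⟩,
    ⟨F₂ ∪ F₄, hF₂.union hF₄, fun x hx ↦ ?_⟩⟩
  · by_cases hxK : x ∈ interior K'
    · exact relImage_mono subset_union_right (h₃ (interior_subset hxK))
    rcases hfF (secSupport_fsmul _ _ hx) with h | h
    · exact relImage_mono subset_union_left h
    · exact absurd hx (notMem_secSupport.2 ((hχ0 x ⟨h, hxK⟩).mono fun y hy ↦ by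
        simp [fsmul_apply, hy]))
  · by_cases hxK : x ∈ interior K'
    · exact relImage_mono subset_union_right (h₄ (interior_subset hxK))
    have hxf : x ∈ secSupport f := by
      by_contra h
      exact notMem_secSupport.2 ((notMem_secSupport.1 h).mono fun y hy ↦ by
        simp [fsmul_apply, hy]) hx
    rcases hfF hxf with h | h
    · exact absurd hx (notMem_secSupport.2 ((hχ1 x ⟨h, hxK⟩).mono fun y hy ↦ by
        simp [fsmul_apply, hy]))
    · exact relImage_mono subset_union_left h

end CausalPropagator

/-! ### Kernel and range of the causal propagator -/

section CausalPropagator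

variable {n : ℕ} {M : Type*} [TopologicalSpace M] [ChartedSpace (EuclideanSpace ℝ (Fin n)) M]
  {F : Type*} [NormedAddCommGroup F] [NormedSpace ℂ F]
  {V : M → Type*} [∀ x, AddCommGroup (V x)] [∀ x, Module ℂ (V x)] [∀ x, TopologicalSpace (V x)]
  [TopologicalSpace (TotalSpace F V)] [FiberBundle F V]
  [VectorBundle ℂ F V] [VectorBundle ℝ F V]
  [IsManifold (𝓡 n) ∞ M] {L : SmoothSections n F V →ₗ[ℂ] SmoothSections n F V}

namespace HasPropagators

variable {S : TimeOrientedLorentzMetric n M} (hD : HasPropagators S L)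

/-- The retarded propagator. -/
def retarded : CompactSections n F V →ₗ[ℂ] SmoothSections n F V := hD.1.choose

/-- The advanced propagator. -/
def advanced : CompactSections n F V →ₗ[ℂ] SmoothSections n F V := hD.2.choose

theorem isPropagator_retarded :
    IsPropagator (relImage (Relation.ReflTransGen S.CausalStep)) L hD.retarded :=
  hD.1.choose_spec

theorem isPropagator_advanced :
    IsPropagator (relImage (Function.swap (Relation.ReflTransGen S.CausalStep))) L hD.advanced :=
  hD.2.choose_spec

theorem causal_apply (u : CompactSections n F V) :
    hD.causal u = hD.retarded u - hD.advanced u := rfl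

theorem causal_sub (u v : CompactSections n F V) :
    hD.causal (u - v) = hD.causal u - hD.causal v :=
  LinearMap.map_sub hD.causal u v

theorem map_causal (u : CompactSections n F V) : L (hD.causal u) = 0 := by
  rw [causal_apply, map_sub, hD.isPropagator_retarded.right_inv,
    hD.isPropagator_advanced.right_inv, sub_self]

theorem causal_mem_spaceCompactSections (u : CompactSections n F V) :
    hD.causal u ∈ SpaceCompactSections F V S := by
  have h1 : hD.retarded u ∈ SpaceCompactSections F V S :=
    ⟨_, u.2, (hD.isPropagator_retarded.support u).trans subset_union_left⟩
  have h2 : hD.advanced u ∈ SpaceCompactSections F V S :=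
    ⟨_, u.2, (hD.isPropagator_advanced.support u).trans subset_union_right⟩
  exact Submodule.sub_mem _ h1 h2

theorem causal_eq_zero_of_eq_map (u w : CompactSections n F V)
    (hw : (w : SmoothSections n F V) = L u) : hD.causal w = 0 := by
  rw [causal_apply, hD.isPropagator_retarded.left_inv u w hw,
    hD.isPropagator_advanced.left_inv u w hw, sub_self]

theorem eq_zero_of_map_eq_zero (hD : HasPropagators S L) {u : SmoothSections n F V} (hu : u ∈ CompactSections n F V)
    (hLu : L u = 0) : u = 0 := by
  have h := hD.isPropagator_retarded.left_inv ⟨u, hu⟩ 0 hLu.symm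
  rw [map_zero] at h
  exact h.symm

/-- Operators that agree on the range of `L` agree on the compactly supported sections. -/
theorem eq_of_comp_eq (hD : HasPropagators S L)
    {A B : SmoothSections n F V →ₗ[ℂ] SmoothSections n F V}
    (hAB : ∀ u, A (L u) = B (L u)) {u : SmoothSections n F V} (hu : u ∈ CompactSections n F V) :
    A u = B u := by
  have h := hD.isPropagator_retarded.right_inv ⟨u, hu⟩
  rw [← show L (hD.retarded ⟨u, hu⟩) = u from h, hAB]

/-- The kernel of the causal propagator is the range of `L` on compactly supported sections. -/
theorem exists_eq_map_of_causal_eq_zero (hS : S.IsGloballyHyperbolic) {u : CompactSections n F V}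
    (hu : hD.causal u = 0) : ∃ w ∈ CompactSections n F V, L w = u := by
  have hR := hS.isCausalRelation
  -- If `G⁺ u = G⁻ u`, this section has both bounded past and bounded future, hence compact support.
  refine ⟨hD.retarded u, ?_, hD.isPropagator_retarded.right_inv u⟩
  obtain ⟨F₁, hF₁, h₁⟩ := hD.isPropagator_retarded.hasBoundedPast hR u
  obtain ⟨F₂, hF₂, h₂⟩ := hD.isPropagator_advanced.hasBoundedPast hR.swap u
  rw [causal_apply, sub_eq_zero] at hu
  rw [← hu] at h₂
  exact (hR.isCompact_relImage_inter hF₁ hF₂).of_isClosed_subset isClosed_closure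
    (subset_inter h₁ h₂)

variable [T2Space M] [SecondCountableTopology M]

theorem comm (hS : S.IsGloballyHyperbolic) (hL : IsLocalOp L)
    {A B : SmoothSections n F V →ₗ[ℂ] SmoothSections n F V}
    (hB : IsLocalOp B) (hAB : ∀ u, A (L u) = L (B u)) (u w : CompactSections n F V)
    (hw : (w : SmoothSections n F V) = A u) : B (hD.causal u) = hD.causal w := by
  rw [causal_apply, causal_apply, map_sub,
    hD.isPropagator_retarded.comm hS.isCausalRelation hL hB hAB u w hw,
    hD.isPropagator_advanced.comm hS.isCausalRelation.swap hL hB hAB u w hw]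

/-- The causal propagator maps onto the space-compact solutions. -/
theorem exists_causal_eq (hS : S.IsGloballyHyperbolic) (hL : IsLocalOp L)
    {f : SmoothSections n F V} (hf : f ∈ SpaceCompactSections F V S) (hLf : L f = 0) :
    ∃ u : CompactSections n F V, hD.causal u = f := by
  have hR := hS.isCausalRelation
  obtain ⟨g, hg, hfg⟩ := exists_past_future_decomposition hS hf
  -- So `L g` has bounded past and bounded future and is a compactly supported source. By uniqueness
  -- `g = G⁺ (L g)` and `g - f = G⁻ (L g)`, whose difference is `f`.
  have hLg : L g = - L (f - g) := by rw [map_sub, hLf, zero_sub, neg_neg]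
  have hu : L g ∈ CompactSections n F V := by
    obtain ⟨F₁, hF₁, h₁⟩ := hL.hasBoundedPast hg
    obtain ⟨F₂, hF₂, h₂⟩ := hL.hasBoundedPast hfg
    refine (hR.isCompact_relImage_inter hF₁ hF₂).of_isClosed_subset isClosed_closure
      (subset_inter h₁ ?_)
    rw [hLg, ← neg_one_smul ℂ]
    exact (secSupport_smul _ _).trans h₂
  have hneg : HasBoundedPast (Function.swap (Relation.ReflTransGen S.CausalStep)) (g - f) := by
    obtain ⟨F₂, hF₂, h₂⟩ := hfg
    refine ⟨F₂, hF₂, ?_⟩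
    rw [← neg_sub f g, ← neg_one_smul ℂ]
    exact (secSupport_smul _ _).trans h₂
  refine ⟨⟨L g, hu⟩, ?_⟩
  rw [causal_apply, ← hD.isPropagator_retarded.eq_apply hR hL hg ⟨_, hu⟩ rfl,
    ← hD.isPropagator_advanced.eq_apply hR.swap hL hneg ⟨_, hu⟩ (by rw [map_sub, hLf, sub_zero]),
    sub_sub_cancel]

end HasPropagators

end CausalPropagator

/-! ### Maps and forms on quotients -/

section LinearAlgebra

variable {X Y : Type*} [AddCommGroup X] [Module ℂ X] [AddCommGroup Y] [Module ℂ Y]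

/-- A map `E₁ → E₂` onto `E₂` under which `F₁` is the preimage of `F₂` induces an isomorphism
`E₁ / F₁ ≃ E₂ / F₂`. -/
theorem exists_isInducedMap {D E₁ F₁ : Submodule ℂ X} {E₂ F₂ : Submodule ℂ Y} (A : D →ₗ[ℂ] Y)
    (hE : E₁ ≤ D) (hmap : ∀ u : E₁, A ⟨u, hE u.2⟩ ∈ E₂)
    (hF : ∀ u : E₁, A ⟨u, hE u.2⟩ ∈ F₂ ↔ (u : X) ∈ F₁)
    (hsurj : ∀ w ∈ E₂, ∃ u : E₁, A ⟨u, hE u.2⟩ = w) :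
    ∃ e : QuotSpace E₁ F₁ ≃ₗ[ℂ] QuotSpace E₂ F₂, IsInducedMap A hE e := by
  set f : E₁ →ₗ[ℂ] QuotSpace E₂ F₂ := (F₂.submoduleOf E₂).mkQ ∘ₗ
    LinearMap.codRestrict E₂ (A ∘ₗ Submodule.inclusion hE) hmap with hf
  have hker : LinearMap.ker f = F₁.submoduleOf E₁ := by
    ext u
    rw [LinearMap.mem_ker, hf, LinearMap.comp_apply, Submodule.mkQ_apply,
      Submodule.Quotient.mk_eq_zero]
    exact hF u
  have hsf : Function.Surjective f := by
    intro y
    obtain ⟨w, rfl⟩ := Submodule.Quotient.mk_surjective _ y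
    obtain ⟨u, hu⟩ := hsurj w w.2
    have h : (⟨_, hmap u⟩ : E₂) = w := Subtype.ext hu
    exact ⟨u, congrArg (QuotSpace.mk F₂) h⟩
  exact ⟨(Submodule.quotEquivOfEq _ _ hker.symm).trans (f.quotKerEquivOfSurjective hsf),
    fun u ↦ ⟨⟨_, hmap u⟩, rfl, rfl⟩⟩

/-- A sesquilinear form descends along a surjection whose kernel lies in both of its kernels. -/
theorem exists_sesquilinear_descent {Q : X →ₗ[ℂ] Y} (hQ : Function.Surjective Q)
    (b : X →ₗ⋆[ℂ] X →ₗ[ℂ] ℂ) (hl : ∀ u v, Q u = 0 → b u v = 0) (hr : ∀ u v, Q v = 0 → b u v = 0) :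
    ∃ b' : Y →ₗ⋆[ℂ] Y →ₗ[ℂ] ℂ, ∀ u v, b' (Q u) (Q v) = b u v := by
  -- The form is pulled back along a linear section `s`; since `s (Q u)` and `u` differ by an
  -- element of `Ker Q`, its values do not depend on `s`.
  obtain ⟨s, hs⟩ := Q.exists_rightInverse_of_surjective (LinearMap.range_eq_top.2 hQ)
  have hs' : ∀ y, Q (s y) = y := fun y ↦ LinearMap.congr_fun hs y
  refine ⟨(b.comp s).compl₂ s, fun u v ↦ ?_⟩
  have h1 : b (s (Q u)) (s (Q v)) - b u (s (Q v)) = 0 := by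
    rw [← LinearMap.sub_apply, ← map_sub]
    exact hl _ _ (by rw [map_sub, hs', sub_self])
  have h2 : b u (s (Q v)) - b u v = 0 := by
    rw [← map_sub]
    exact hr _ _ (by rw [map_sub, hs', sub_self])
  exact (sub_eq_zero.1 h1).trans (sub_eq_zero.1 h2)

/-- A sesquilinear form on `E` with `F` in both of its kernels descends to `E / F`. -/
theorem exists_sesquilinear_quotSpace {E F : Submodule ℂ X} (b : E →ₗ⋆[ℂ] E →ₗ[ℂ] ℂ)
    (hl : ∀ u v : E, (u : X) ∈ F → b u v = 0) (hr : ∀ u v : E, (v : X) ∈ F → b u v = 0) :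
    ∃ q : QuotSpace E F →ₗ⋆[ℂ] QuotSpace E F →ₗ[ℂ] ℂ,
      ∀ u v : E, q (QuotSpace.mk F u) (QuotSpace.mk F v) = b u v :=
  exists_sesquilinear_descent (Q := (F.submoduleOf E).mkQ) (Submodule.mkQ_surjective _) b
    (fun u v hu ↦ hl u v ((Submodule.Quotient.mk_eq_zero (F.submoduleOf E)).1 hu))
    fun u v hv ↦ hr u v ((Submodule.Quotient.mk_eq_zero (F.submoduleOf E)).1 hv)

end LinearAlgebra

/-! ### The isomorphism induced by the causal propagator -/

section BRST

variable {n : ℕ} {M : Type*} [TopologicalSpace M]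
  [ChartedSpace (EuclideanSpace ℝ (Fin n)) M] [IsManifold (𝓡 n) ∞ M] [MeasurableSpace M]
  {F : Type*} [NormedAddCommGroup F] [NormedSpace ℂ F]
  {V : M → Type*} [∀ x, AddCommGroup (V x)] [∀ x, Module ℂ (V x)] [∀ x, TopologicalSpace (V x)]
  [TopologicalSpace (TotalSpace F V)] [FiberBundle F V]
  [VectorBundle ℂ F V] [VectorBundle ℝ F V]
  {S : TimeOrientedLorentzMetric n M} {μ : Measure M} {h : HermitianStructure n F V}
  {P : GhostGrading n F V} {γ γs L : SmoothSections n F V →ₗ[ℂ] SmoothSections n F V}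

namespace IsBRST

variable (hB : IsBRST S μ h P γ γs L) (hD : HasPropagators S L)
include hB

theorem project_L (i : ℤ) (u : SmoothSections n F V) :
    P.project (-i) (L u) = L (P.project i u) :=
  (P.map_project P neg_injective hB.degree_L i u).symm

theorem project_γ (i : ℤ) (u : SmoothSections n F V) :
    P.project (i - 1) (γ u) = γ (P.project i u) :=
  (P.map_project P (sub_left_injective (b := (1 : ℤ))) hB.degree_γ i u).symm

/-- Every compactly supported section is `L v` for some smooth `v`, and `γ* γ* L v = L γ γ v = 0`.
-/
theorem γs_γs (hD : HasPropagators S L) {u : SmoothSections n F V} (hu : u ∈ CompactSections n F V) : γs (γs u) = 0 :=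
  hD.eq_of_comp_eq (A := γs ∘ₗ γs) (B := 0)
    (fun v ↦ by simp [hB.intertwine, hB.γ_γ]) hu

/-- The degree of `γ*` is read off from `γ* L = L γ`: since `L` reverses degrees, lowering by `γ`
becomes raising by `γ*`. -/
theorem project_γs (hD : HasPropagators S L) (i : ℤ) {u : SmoothSections n F V} (hu : u ∈ CompactSections n F V) :
    P.project (i + 1) (γs u) = γs (P.project i u) := by
  refine hD.eq_of_comp_eq (A := P.project (i + 1) ∘ₗ γs) (B := γs ∘ₗ P.project i)
    (fun v ↦ ?_) hu
  have h1 := hB.project_L (-(i + 1)) (γ v)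
  have h2 := hB.project_L (-i) v
  have h3 := hB.project_γ (-i) v
  rw [neg_neg] at h1 h2
  rw [show -i - 1 = -(i + 1) by ring] at h3
  simp only [LinearMap.comp_apply]
  rw [hB.intertwine, h1, h2, hB.intertwine, h3]

variable [T2Space M] [SecondCountableTopology M]
theorem map_γs_mem {u : SmoothSections n F V} (hu : u ∈ CompactSections n F V) :
    γs u ∈ CompactSections n F V := hB.diffOp_γs.isLocalOp.mem_compactSections hu

theorem γ_causal (hS : S.IsGloballyHyperbolic) (u w : CompactSections n F V)
    (hw : (w : SmoothSections n F V) = γs u) : γ (hD.causal u) = hD.causal w :=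
  hD.comm hS hB.diffOp_L.isLocalOp hB.diffOp_γ.isLocalOp hB.intertwine u w hw

theorem project_causal (hS : S.IsGloballyHyperbolic) (i : ℤ) (u w : CompactSections n F V)
    (hw : (w : SmoothSections n F V) = P.project (-i) u) :
    P.project i (hD.causal u) = hD.causal w :=
  hD.comm hS hB.diffOp_L.isLocalOp (P.isLocalOp_project i) (hB.project_L i) u w hw

theorem pairing_γs (u : CompactSections n F V) (v : SmoothSections n F V) :
    h.pairing μ (γs u) v = h.pairing μ u (γ v) :=
  hB.adjoint.pairing_eq hB.diffOp_γ.isLocalOp hB.diffOp_γs.isLocalOp u.2 v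

theorem pairing_L (u : CompactSections n F V) (v : SmoothSections n F V) :
    h.pairing μ (L u) v = h.pairing μ u (L v) :=
  hB.selfAdjoint.pairing_eq hB.diffOp_L.isLocalOp hB.diffOp_L.isLocalOp u.2 v

theorem brstDen_le_brstNum (hD : HasPropagators S L) : brstDen γs L P ≤ brstNum γs P := by
  refine inf_le_inf_right _ (sup_le ?_ inf_le_right)
  rintro _ ⟨u, hu, rfl⟩
  exact ⟨hB.map_γs_mem hu, hB.γs_γs hD hu⟩

theorem causal_mem_degree_zero (hS : S.IsGloballyHyperbolic) (u : CompactSections n F V)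
    (hu : (u : SmoothSections n F V) ∈ P.degree 0) : hD.causal u ∈ P.degree 0 :=
  P.mem_degree_iff.2 <| hB.project_causal hD hS 0 u u (P.mem_degree_iff.1 hu).symm

/-- By `γ G = G γ*` the denominator consists of the `γ`-images of solutions; in this form it can be
compared with the range of `γ_Σ`. -/
theorem mem_solDen_iff (hS : S.IsGloballyHyperbolic) {f : SmoothSections n F V} :
    f ∈ solDen γs hD.causal P ↔
      (∃ w : CompactSections n F V, γ (hD.causal w) = f) ∧ f ∈ P.degree 0 := by
  refine and_congr_left' ⟨?_, ?_⟩
  · rintro ⟨u, ⟨w, hw, hwu⟩, rfl⟩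
    exact ⟨⟨w, hw⟩, hB.γ_causal hD hS _ _ hwu.symm⟩
  · rintro ⟨w, rfl⟩
    exact ⟨⟨γs w, hB.map_γs_mem w.2⟩, ⟨w, w.2, rfl⟩, (hB.γ_causal hD hS _ _ rfl).symm⟩

theorem solDen_le_solNum (hS : S.IsGloballyHyperbolic) :
    solDen γs hD.causal P ≤ solNum S γ L P := by
  intro f hf
  obtain ⟨⟨w, rfl⟩, hf0⟩ := (hB.mem_solDen_iff hD hS).1 hf
  have hsc := hB.diffOp_γ.isLocalOp.mem_spaceCompactSections
    (hD.causal_mem_spaceCompactSections w)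
  exact ⟨⟨⟨hsc, LinearMap.mem_ker.2 <| by
    rw [← hB.intertwine, hD.map_causal, map_zero]⟩, hsc, hB.γ_γ _⟩, hf0⟩

theorem causal_mem_solNum (hS : S.IsGloballyHyperbolic) (u : CompactSections n F V)
    (hu : (u : SmoothSections n F V) ∈ brstNum γs P) : hD.causal u ∈ solNum S γ L P := by
  have hsc := hD.causal_mem_spaceCompactSections u
  have h0 : γs u = 0 := hu.1.2
  refine ⟨⟨⟨hsc, hD.map_causal u⟩, hsc, LinearMap.mem_ker.2 ?_⟩,
    hB.causal_mem_degree_zero hD hS u hu.2⟩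
  rw [hB.γ_causal hD hS u 0 h0.symm, map_zero]

/-- Well-definedness and injectivity of `[G_L]` at once: `G u = G γ* w` exactly when `u - γ* w` is
some `L z`, and this `L z` lies in `Ker γ*` because `u` and `γ* w` do. -/
theorem causal_mem_solDen_iff (hS : S.IsGloballyHyperbolic) (u : CompactSections n F V)
    (hu : (u : SmoothSections n F V) ∈ brstNum γs P) :
    hD.causal u ∈ solDen γs hD.causal P ↔
      (u : SmoothSections n F V) ∈ brstDen γs L P := by
  rw [hB.mem_solDen_iff hD hS, and_iff_left (hB.causal_mem_degree_zero hD hS u hu.2)]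
  constructor
  · rintro ⟨w, hw⟩
    set w' : CompactSections n F V := ⟨γs w, hB.map_γs_mem w.2⟩
    obtain ⟨z, hz, hzu⟩ := hD.exists_eq_map_of_causal_eq_zero hS (u := u - w') (by
      rw [hD.causal_sub, ← hw, hB.γ_causal hD hS w w' rfl, sub_self])
    refine ⟨Submodule.mem_sup.2 ⟨γs w, ⟨w, w.2, rfl⟩, L z, ⟨⟨z, hz, rfl⟩, ?_⟩, ?_⟩, hu.2⟩
    · refine ⟨hB.diffOp_L.isLocalOp.mem_compactSections hz, LinearMap.mem_ker.2 ?_⟩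
      have h0 : γs u = 0 := hu.1.2
      rw [hzu, Submodule.coe_sub, map_sub, h0, hB.γs_γs hD w.2, sub_zero]
    · rw [hzu, Submodule.coe_sub, add_sub_cancel]
  · rintro ⟨hu', -⟩
    obtain ⟨_, ⟨w, hw, rfl⟩, _, ⟨⟨z, hz, rfl⟩, hLz⟩, hwz⟩ := Submodule.mem_sup.1 hu'
    refine ⟨⟨w, hw⟩, ?_⟩
    have hu2 : u = ⟨γs w, hB.map_γs_mem hw⟩ + ⟨L z, hLz.1⟩ := Subtype.ext hwz.symm
    rw [hu2, map_add, hD.causal_eq_zero_of_eq_map ⟨z, hz⟩ ⟨L z, hLz.1⟩ rfl, add_zero]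
    exact hB.γ_causal hD hS _ _ rfl

/-- Every solution in `Ker γ` of degree zero is of the form `G u` with `γ* u = 0`. -/
theorem exists_causal_eq_of_mem_solNum (hS : S.IsGloballyHyperbolic) {f : SmoothSections n F V}
    (hf : f ∈ solNum S γ L P) : ∃ u : brstNum γs P,
      hD.causal ⟨u, brstNum_le γs P u.2⟩ = f := by
  obtain ⟨⟨⟨hfsc, hLf⟩, -, hγf⟩, hf0⟩ := hf
  have hL := hB.diffOp_L.isLocalOp
  obtain ⟨u₀, rfl⟩ := hD.exists_causal_eq hS hL hfsc hLf
  set u : CompactSections n F V :=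
    ⟨P.project 0 u₀, (P.isLocalOp_project 0).mem_compactSections u₀.2⟩ with hu
  have hGu : hD.causal u = hD.causal u₀ := by
    rw [← hB.project_causal hD hS 0 u₀ u rfl, P.mem_degree_iff.1 hf0]
  have hu0 : P.project 0 u = u := by rw [hu, P.project_project, if_pos rfl]
  obtain ⟨w₀, hw₀, hLw₀⟩ := hD.exists_eq_map_of_causal_eq_zero hS
    (u := ⟨γs u, hB.map_γs_mem u.2⟩) (by
      rw [← hB.γ_causal hD hS u _ rfl, hGu]; exact hγf)
  -- As `γ* u` has degree 1 and `L` reverses degrees, the degree -1 part of `w₀` is already mapped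
  -- to `γ* u`; this is the degree of the homology hypothesis.
  set w := P.project (-1) w₀
  have hw : w ∈ CompactSections n F V := (P.isLocalOp_project _).mem_compactSections hw₀
  have hLw : L w = γs u := by
    have h1 := hB.project_γs hD 0 u.2
    rw [← hB.project_L, neg_neg, hLw₀, ← zero_add (1 : ℤ), h1, hu0]
  have hγw : γ w = 0 := by
    refine hD.eq_zero_of_map_eq_zero (hB.diffOp_γ.isLocalOp.mem_compactSections hw) ?_
    rw [← hB.intertwine, hLw, hB.γs_γs hD u.2]
  obtain ⟨z₀, hz₀, hγz₀⟩ := hB.homology ⟨⟨hw, hγw⟩, P.project_mem_degree _ _⟩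
  set z := P.project 0 z₀
  have hz : z ∈ CompactSections n F V := (P.isLocalOp_project _).mem_compactSections hz₀
  have hγz : γ z = w := by
    rw [← hB.project_γ, hγz₀, zero_sub, P.project_project, if_pos rfl]
  have hLz := hL.mem_compactSections hz
  -- Subtracting `L z` leaves `G u` unchanged and removes `γ* u`, because `γ* L z = L γ z = L w = γ*
  -- u`.
  refine ⟨⟨u - L z, ⟨Submodule.sub_mem _ u.2 hLz, LinearMap.mem_ker.2 ?_⟩, Submodule.sub_mem _ ?_ ?_⟩, ?_⟩
  · rw [map_sub, hB.intertwine, hγz, hLw, sub_self]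
  · exact P.project_mem_degree _ _
  · simpa using hB.degree_L 0 z (P.project_mem_degree _ _)
  · have : (⟨u - L z, Submodule.sub_mem _ u.2 hLz⟩ : CompactSections n F V) = u - ⟨L z, hLz⟩ := rfl
    rw [this, hD.causal_sub, hD.causal_eq_zero_of_eq_map ⟨z, hz⟩ ⟨L z, hLz⟩ rfl, sub_zero, hGu]

theorem pairing_causal_eq_zero_left (hS : S.IsGloballyHyperbolic) [BorelSpace M]
    [IsFiniteMeasureOnCompacts μ] (u v : CompactSections n F V)
    (hu : (u : SmoothSections n F V) ∈ brstDen γs L P)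
    (hv : (v : SmoothSections n F V) ∈ brstNum γs P) :
    h.compactPairing μ u (hD.causal v) = 0 := by
  obtain ⟨_, ⟨w, hw, rfl⟩, _, ⟨⟨z, hz, rfl⟩, hLz⟩, hwz⟩ := Submodule.mem_sup.1 hu.1
  have hu2 : u = ⟨γs w, hB.map_γs_mem hw⟩ + ⟨L z, hLz.1⟩ := Subtype.ext hwz.symm
  rw [hu2, map_add, LinearMap.add_apply, h.compactPairing_apply, h.compactPairing_apply,
    hB.pairing_γs ⟨w, hw⟩, hB.pairing_L ⟨z, hz⟩, hD.map_causal,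
    show γ (hD.causal v) = 0 from (hB.causal_mem_solNum hD hS v hv).1.2.2,
    ← h.compactPairing_apply, ← h.compactPairing_apply, map_zero, map_zero, add_zero]

/-- Here `G v = γ G w` for some `w`, and moving `γ` to the left gives `(γ* u|G w) = 0`;
skew-adjointness of `G` does not enter. -/
theorem pairing_causal_eq_zero_right (hS : S.IsGloballyHyperbolic) [BorelSpace M]
    [IsFiniteMeasureOnCompacts μ] (u v : CompactSections n F V)
    (hu : (u : SmoothSections n F V) ∈ brstNum γs P)
    (hv : (v : SmoothSections n F V) ∈ brstDen γs L P) :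
    h.compactPairing μ u (hD.causal v) = 0 := by
  have h1 := (hB.causal_mem_solDen_iff hD hS v (hB.brstDen_le_brstNum hD hv)).2 hv
  obtain ⟨⟨w, hw⟩, -⟩ := (hB.mem_solDen_iff hD hS).1 h1
  have h0 : (⟨γs u, hB.map_γs_mem u.2⟩ : CompactSections n F V) = 0 := Subtype.ext hu.1.2
  rw [← hw, h.compactPairing_apply, ← hB.pairing_γs]
  change h.compactPairing μ ⟨γs u, hB.map_γs_mem u.2⟩ _ = 0
  rw [h0, map_zero, LinearMap.zero_apply]

/-- The form `q` on `𝒱`. -/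
theorem exists_phase_form (hS : S.IsGloballyHyperbolic) [BorelSpace M]
    [IsFiniteMeasureOnCompacts μ] :
    ∃ q : QuotSpace (brstNum γs P) (brstDen γs L P) →ₗ⋆[ℂ]
        QuotSpace (brstNum γs P) (brstDen γs L P) →ₗ[ℂ] ℂ,
      ∀ u v : brstNum γs P, q (QuotSpace.mk _ u) (QuotSpace.mk _ v) =
        Complex.I⁻¹ * h.pairing μ u (hD.causal ⟨v, brstNum_le γs P v.2⟩) := by
  let j := Submodule.inclusion (brstNum_le γs P)
  let b : brstNum γs P →ₗ⋆[ℂ] brstNum γs P →ₗ[ℂ] ℂ :=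
    Complex.I⁻¹ • ((h.compactPairing μ).comp j).compl₂ (hD.causal ∘ₗ j)
  have hb : ∀ u v, b u v = Complex.I⁻¹ * h.compactPairing μ (j u) (hD.causal (j v)) :=
    fun _ _ ↦ rfl
  exact exists_sesquilinear_quotSpace b
    (fun u v hu ↦ by
      rw [hb, hB.pairing_causal_eq_zero_left hD hS (j u) (j v) hu v.2, mul_zero])
    fun u v hv ↦ by
      rw [hb, hB.pairing_causal_eq_zero_right hD hS (j u) (j v) u.2 hv, mul_zero]

end IsBRST

end BRST

/-! ### Transport to Cauchy data -/

section CauchyData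

variable {n : ℕ} {M : Type*} [TopologicalSpace M]
  [ChartedSpace (EuclideanSpace ℝ (Fin n)) M] [IsManifold (𝓡 n) ∞ M]
  {F : Type*} [NormedAddCommGroup F] [NormedSpace ℂ F]
  {V : M → Type*} [∀ x, AddCommGroup (V x)] [∀ x, Module ℂ (V x)] [∀ x, TopologicalSpace (V x)]
  [TopologicalSpace (TotalSpace F V)] [FiberBundle F V]
  [VectorBundle ℂ F V] [VectorBundle ℝ F V]
  {S : TimeOrientedLorentzMetric n M}
  {d : ℕ} {N : Type*} [TopologicalSpace N] [ChartedSpace (EuclideanSpace ℝ (Fin d)) N]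
  {F' : Type*} [NormedAddCommGroup F'] [NormedSpace ℂ F']
  {W : N → Type*} [∀ x, AddCommGroup (W x)] [∀ x, Module ℂ (W x)] [∀ x, TopologicalSpace (W x)]
  [TopologicalSpace (TotalSpace F' W)] [FiberBundle F' W]
  [VectorBundle ℂ F' W] [VectorBundle ℝ F' W]
  {γ γs L : SmoothSections n F V →ₗ[ℂ] SmoothSections n F V} {ι : N → M}
  {ρ : SmoothSections n F V →ₗ[ℂ] SmoothSections d F' W}
  {P : GhostGrading n F V} {Pρ : GhostGrading d F' W}

namespace IsCauchyDataMap

variable (hρ : IsCauchyDataMap S L ι ρ)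

theorem U_mem (φ : CompactSections d F' W) : hρ.U φ ∈ SpaceCompactSections F V S :=
  (hρ.solutionEquiv.symm φ).2.1

theorem map_U (φ : CompactSections d F' W) : L (hρ.U φ) = 0 := (hρ.solutionEquiv.symm φ).2.2

theorem rho_U (φ : CompactSections d F' W) : ρ (hρ.U φ) = φ :=
  congrArg Subtype.val (hρ.solutionEquiv.apply_symm_apply φ)

theorem gammaSigma_apply (φ : CompactSections d F' W) : hρ.gammaSigma γ φ = ρ (γ (hρ.U φ)) := rfl

/-- A space-compact solution is determined by its Cauchy data. -/
theorem solution_ext (hρ : IsCauchyDataMap S L ι ρ) {f f' : SmoothSections n F V} (hf : f ∈ SpaceCompactSections F V S)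
    (hLf : L f = 0) (hf' : f' ∈ SpaceCompactSections F V S) (hLf' : L f' = 0)
    (h : ρ f = ρ f') : f = f' :=
  (hρ.cauchy (ρ f') (hρ.maps _ hf')).unique ⟨hf, hLf, h⟩ ⟨hf', hLf', rfl⟩

theorem U_rho {f : SmoothSections n F V} (hf : f ∈ SpaceCompactSections F V S) (hLf : L f = 0)
    (φ : CompactSections d F' W) (hφ : (φ : SmoothSections d F' W) = ρ f) : hρ.U φ = f :=
  hρ.solution_ext (hρ.U_mem φ) (hρ.map_U φ) hf hLf (by rw [hρ.rho_U, hφ])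

/-- The Cauchy data of the solution `G u`. -/
def causalData (hD : HasPropagators S L) : CompactSections n F V →ₗ[ℂ] CompactSections d F' W :=
  LinearMap.codRestrict _ (ρ ∘ₗ hD.causal) fun u ↦
    hρ.maps _ (hD.causal_mem_spaceCompactSections u)

theorem coe_causalData (hD : HasPropagators S L) (u : CompactSections n F V) :
    (hρ.causalData hD u : SmoothSections d F' W) = ρ (hD.causal u) := rfl

theorem causal_eq_zero_of_causalData_eq_zero (hD : HasPropagators S L) {u : CompactSections n F V}
    (hu : hρ.causalData hD u = 0) : hD.causal u = 0 :=
  hρ.solution_ext (hD.causal_mem_spaceCompactSections u) (hD.map_causal u) (zero_mem _)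
    (map_zero L) (by rw [map_zero]; exact congrArg Subtype.val hu)

theorem rho_mem_cycles (hdeg : ∀ i, ∀ u ∈ P.degree i, ρ u ∈ Pρ.degree i)
    {f : SmoothSections n F V} (hf : f ∈ solNum S γ L P) : ρ f ∈ hρ.cycles γ Pρ := by
  obtain ⟨⟨⟨hfsc, hLf⟩, -, hγf⟩, hf0⟩ := hf
  refine ⟨⟨⟨ρ f, hρ.maps f hfsc⟩, LinearMap.mem_ker.2 ?_, rfl⟩, hdeg 0 f hf0⟩
  rw [hρ.gammaSigma_apply, hρ.U_rho hfsc hLf _ rfl, show γ f = 0 from hγf, map_zero]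

end IsCauchyDataMap

namespace IsBRST

variable [T2Space M] [SecondCountableTopology M] [MeasurableSpace M]
  {μ : Measure M} {h : HermitianStructure n F V}
  (hB : IsBRST S μ h P γ γs L) (hρ : IsCauchyDataMap S L ι ρ)
include hB

theorem γ_U_mem (φ : CompactSections d F' W) : γ (hρ.U φ) ∈ SpaceCompactSections F V S :=
  hB.diffOp_γ.isLocalOp.mem_spaceCompactSections (hρ.U_mem φ)

theorem gammaSigma_mem (φ : CompactSections d F' W) :
    hρ.gammaSigma γ φ ∈ CompactSections d F' W := hρ.maps _ (hB.γ_U_mem hρ φ)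

/-- `γ` preserves space-compact solutions since `L γ = γ* L`, so `γ U φ` is the solution with data
`γ_Σ φ`. Thus `U` intertwines `γ_Σ` with `γ`, and `γ_Σ² = 0`. -/
theorem U_gammaSigma (φ ψ : CompactSections d F' W)
    (hψ : (ψ : SmoothSections d F' W) = hρ.gammaSigma γ φ) : hρ.U ψ = γ (hρ.U φ) :=
  hρ.U_rho (hB.γ_U_mem hρ φ) (by rw [← hB.intertwine, hρ.map_U, map_zero]) ψ hψ

theorem boundaries_le_cycles : hρ.boundaries γ Pρ ≤ hρ.cycles γ Pρ := by
  rintro _ ⟨⟨φ, rfl⟩, h0⟩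
  refine ⟨⟨⟨_, hB.gammaSigma_mem hρ φ⟩, LinearMap.mem_ker.2 ?_, rfl⟩, h0⟩
  rw [hρ.gammaSigma_apply, hB.U_gammaSigma hρ φ _ rfl, hB.γ_γ, map_zero]

theorem rho_mem_boundaries_iff (hD : HasPropagators S L) (hS : S.IsGloballyHyperbolic)
    (hdeg : ∀ i, ∀ u ∈ P.degree i, ρ u ∈ Pρ.degree i)
    {f : SmoothSections n F V} (hf : f ∈ solNum S γ L P) :
    ρ f ∈ hρ.boundaries γ Pρ ↔ f ∈ solDen γs hD.causal P := by
  rw [hB.mem_solDen_iff hD hS]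
  refine ⟨fun ⟨⟨φ, hφ⟩, _⟩ ↦ ⟨?_, hf.2⟩, fun ⟨⟨w, hw⟩, hf0⟩ ↦ ⟨?_, hdeg 0 f hf0⟩⟩
  · obtain ⟨w, hw⟩ := hD.exists_causal_eq hS hB.diffOp_L.isLocalOp (hρ.U_mem φ) (hρ.map_U φ)
    refine ⟨w, ?_⟩
    rw [hw]
    exact hρ.solution_ext (hB.γ_U_mem hρ φ) (by rw [← hB.intertwine, hρ.map_U, map_zero])
      hf.1.1.1 hf.1.1.2 hφ
  · refine ⟨hρ.causalData hD w, ?_⟩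
    rw [hρ.gammaSigma_apply, hρ.U_rho (hD.causal_mem_spaceCompactSections w) (hD.map_causal w) _
      (hρ.coe_causalData hD w), hw]

/-- Every cycle of degree zero is the Cauchy data of a solution in `Ker γ` of degree zero. -/
theorem exists_rho_eq_of_mem_cycles (hdeg : ∀ i, ∀ u ∈ P.degree i, ρ u ∈ Pρ.degree i)
    {φ : SmoothSections d F' W} (hφ : φ ∈ hρ.cycles γ Pρ) :
    ∃ f ∈ solNum S γ L P, ρ f = φ := by
  obtain ⟨⟨φ, hγφ, rfl⟩, h0⟩ := hφ
  have hγU : γ (hρ.U φ) = 0 :=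
    hρ.solution_ext (hB.γ_U_mem hρ φ) (by rw [← hB.intertwine, hρ.map_U, map_zero]) (zero_mem _)
      (map_zero L) (by rw [map_zero]; exact hγφ)
  refine ⟨hρ.U φ, ⟨⟨⟨hρ.U_mem φ, hρ.map_U φ⟩, hρ.U_mem φ, hγU⟩, P.mem_degree_iff.2 ?_⟩,
    hρ.rho_U φ⟩
  -- The degree 0 part of `U φ` is again a solution, with the same data since `ρ` preserves degrees
  -- and `φ` has degree 0; uniqueness identifies it with `U φ`.
  refine hρ.solution_ext ((P.isLocalOp_project 0).mem_spaceCompactSections (hρ.U_mem φ)) ?_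
    (hρ.U_mem φ) (hρ.map_U φ) ?_
  · rw [← hB.project_L, hρ.map_U, map_zero]
  · rw [P.map_project Pρ Function.injective_id hdeg, hρ.rho_U]
    exact Pρ.mem_degree_iff.1 h0

/-- All Cauchy data come from compactly supported sources, so a form on data is determined by its
values on pairs `ρ G u`, `ρ G v`. -/
theorem causalData_surjective (hD : HasPropagators S L) (hS : S.IsGloballyHyperbolic) :
    Function.Surjective (hρ.causalData hD) := fun φ ↦ by
  obtain ⟨u, hu⟩ := hD.exists_causal_eq hS hB.diffOp_L.isLocalOp (hρ.U_mem φ) (hρ.map_U φ)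
  exact ⟨u, Subtype.ext (by rw [hρ.coe_causalData, hu, hρ.rho_U])⟩

/-- The form `σ_Σ` on Cauchy data. -/
theorem exists_isCauchyForm (hρ : IsCauchyDataMap S L ι ρ) (hD : HasPropagators S L) (hS : S.IsGloballyHyperbolic) [BorelSpace M]
    [IsFiniteMeasureOnCompacts μ] :
    ∃ B : CompactSections d F' W →ₗ⋆[ℂ] CompactSections d F' W →ₗ[ℂ] ℂ,
      IsCauchyForm μ h hD.causal ρ B := by
  obtain ⟨B, hBc⟩ := exists_sesquilinear_descent (X := CompactSections n F V)
    (Y := CompactSections d F' W) (Q := hρ.causalData hD)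
    (hB.causalData_surjective hρ hD hS) ((h.compactPairing μ).compl₂ hD.causal)
    -- Vanishing data give `G u = 0`, so `u = L w` and `(L w|G v) = (w|L G v) = 0`.
    (fun u v hu ↦ by
      obtain ⟨w, hw, hwu⟩ := hD.exists_eq_map_of_causal_eq_zero hS
        (hρ.causal_eq_zero_of_causalData_eq_zero hD hu)
      change h.pairing μ u (hD.causal v) = 0
      rw [← hwu, hB.pairing_L ⟨w, hw⟩, hD.map_causal, ← h.compactPairing_apply, map_zero])
    (fun u v hv ↦ by
      rw [LinearMap.compl₂_apply, hρ.causal_eq_zero_of_causalData_eq_zero hD hv, map_zero])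
  refine ⟨B, fun u v φ ψ hφ hψ ↦ ?_⟩
  obtain rfl : φ = hρ.causalData hD u := Subtype.ext hφ
  obtain rfl : ψ = hρ.causalData hD v := Subtype.ext hψ
  exact hBc u v

end IsBRST

end CauchyData

end

/-! ### Assembly of the theorem -/

theorem mainTheorem2
    {d : ℕ}
    -- the globally hyperbolic spacetime `M`
    {M : Type*} [TopologicalSpace M] [T2Space M] [SecondCountableTopology M]
    [ChartedSpace (EuclideanSpace ℝ (Fin (d + 1))) M] [IsManifold (𝓡 (d + 1)) ∞ M]
    [MeasurableSpace M] [BorelSpace M]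
    (S : TimeOrientedLorentzMetric (d + 1) M) (hS : S.IsGloballyHyperbolic)
    (μ : Measure M) (hμ : IsVolumeMeasure (fun x v w ↦ S.g x v w) μ)
    -- the Cauchy surface `N`, embedded by `ι`
    {N : Type*} [TopologicalSpace N]
    [ChartedSpace (EuclideanSpace ℝ (Fin d)) N] [IsManifold (𝓡 d) ∞ N]
    [MeasurableSpace N] [BorelSpace N]
    (ι : N → M) (hι : S.IsSpacelikeCauchyEmbedding d ι)
    (ν : Measure N) (hν : IsVolumeMeasure (n := d) (S.pullback ι) ν)
    -- the hermitian graded bundle `V` over `M` and the BRST data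
    {F : Type*} [NormedAddCommGroup F] [NormedSpace ℂ F] [FiniteDimensional ℂ F]
    {V : M → Type*} [∀ x, AddCommGroup (V x)] [∀ x, Module ℂ (V x)] [∀ x, TopologicalSpace (V x)]
    [TopologicalSpace (TotalSpace F V)] [FiberBundle F V]
    [VectorBundle ℂ F V] [VectorBundle ℝ F V] [ContMDiffVectorBundle ∞ F V (𝓡 (d + 1))]
    (h : HermitianStructure (d + 1) F V) (P : GhostGrading (d + 1) F V)
    (γ γs L : SmoothSections (d + 1) F V →ₗ[ℂ] SmoothSections (d + 1) F V)
    (hBRST : IsBRST S μ h P γ γs L)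
    -- the hermitian graded bundle `W = V_ρ` over `N` and the Cauchy data map `ρ`
    {F' : Type*} [NormedAddCommGroup F'] [NormedSpace ℂ F'] [FiniteDimensional ℂ F']
    {W : N → Type*} [∀ y, AddCommGroup (W y)] [∀ y, Module ℂ (W y)] [∀ y, TopologicalSpace (W y)]
    [TopologicalSpace (TotalSpace F' W)] [FiberBundle F' W]
    [VectorBundle ℂ F' W] [VectorBundle ℝ F' W] [ContMDiffVectorBundle ∞ F' W (𝓡 d)]
    (hW : HermitianStructure d F' W) (Pρ : GhostGrading d F' W)
    (ρ : SmoothSections (d + 1) F V →ₗ[ℂ] SmoothSections d F' W)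
    (hρ : IsCauchyDataMap S L ι ρ)
    (hρ_deg : ∀ i, ∀ u ∈ P.degree i, ρ u ∈ Pρ.degree i) :
    -- `γ_Σ` is an operator on `Γ_c(Σ;V_ρ)`
    (∀ φ, hρ.gammaSigma γ φ ∈ CompactSections d F' W) ∧
    -- the denominators are contained in the numerators
    brstDen γs L P ≤ brstNum γs P ∧
    solDen γs hBRST.green.1.causal P ≤ solNum S γ L P ∧
    hρ.boundaries γ Pρ ≤ hρ.cycles γ Pρ ∧
    -- the bijections induced by `G_L` and by `ρ`
    ∃ (eG : QuotSpace (brstNum γs P) (brstDen γs L P) ≃ₗ[ℂ]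
          QuotSpace (solNum S γ L P) (solDen γs hBRST.green.1.causal P))
      (eρ : QuotSpace (solNum S γ L P) (solDen γs hBRST.green.1.causal P) ≃ₗ[ℂ]
          QuotSpace (hρ.cycles γ Pρ) (hρ.boundaries γ Pρ)),
      IsInducedMap hBRST.green.1.causal (brstNum_le γs P) eG ∧
      IsInducedMap (ρ.domRestrict ⊤) le_top eρ ∧
      -- the sesquilinear form of the causal propagator on Cauchy data
      ∃ B : CompactSections d F' W →ₗ⋆[ℂ] CompactSections d F' W →ₗ[ℂ] ℂ,
        IsCauchyForm μ h hBRST.green.1.causal ρ B ∧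
        (∀ B', IsCauchyForm μ h hBRST.green.1.causal ρ B' → B' = B) ∧
        (∀ T : CompactSections d F' W →ₗ[ℂ] CompactSections d F' W,
          IsCauchyPropagator μ ν h hW hBRST.green.1.causal ρ T ↔
            ∀ φ ψ : CompactSections d F' W, B φ ψ = hW.pairing ν φ (T ψ)) ∧
        -- the forms `q`, `q_Σ` are well defined, and `[ρ] ∘ [G_L]` intertwines them
        ∃ (q : QuotSpace (brstNum γs P) (brstDen γs L P) →ₗ⋆[ℂ]
              QuotSpace (brstNum γs P) (brstDen γs L P) →ₗ[ℂ] ℂ)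
          (qS : QuotSpace (hρ.cycles γ Pρ) (hρ.boundaries γ Pρ) →ₗ⋆[ℂ]
              QuotSpace (hρ.cycles γ Pρ) (hρ.boundaries γ Pρ) →ₗ[ℂ] ℂ),
          (∀ u v : brstNum γs P, q (QuotSpace.mk _ u) (QuotSpace.mk _ v) =
            Complex.I⁻¹ * h.pairing μ u (hBRST.green.1.causal ⟨v, brstNum_le γs P v.2⟩)) ∧
          (∀ (φ ψ : hρ.cycles γ Pρ) (φ' ψ' : CompactSections d F' W),
            (φ' : SmoothSections d F' W) = φ → (ψ' : SmoothSections d F' W) = ψ →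
            qS (QuotSpace.mk _ φ) (QuotSpace.mk _ ψ) = Complex.I⁻¹ * B φ' ψ') ∧
          ∀ x y, qS (eρ (eG x)) (eρ (eG y)) = q x y := by
  have hD := hBRST.green.1
  have hfin : IsFiniteMeasureOnCompacts μ := hμ.isFiniteMeasureOnCompacts S
  obtain ⟨eG, heG⟩ := exists_isInducedMap (F₁ := brstDen γs L P) (F₂ := solDen γs hD.causal P)
    hD.causal (brstNum_le γs P) (fun u ↦ hBRST.causal_mem_solNum hD hS _ u.2)
    (fun u ↦ hBRST.causal_mem_solDen_iff hD hS _ u.2)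
    fun w hw ↦ hBRST.exists_causal_eq_of_mem_solNum hD hS hw
  obtain ⟨eρ, heρ⟩ := exists_isInducedMap (E₁ := solNum S γ L P) (F₁ := solDen γs hD.causal P)
    (F₂ := hρ.boundaries γ Pρ) (ρ.domRestrict ⊤) le_top
    (fun f ↦ hρ.rho_mem_cycles hρ_deg f.2)
    (fun f ↦ hBRST.rho_mem_boundaries_iff hρ hD hS hρ_deg f.2)
    fun φ hφ ↦ by
      obtain ⟨f, hf, hfφ⟩ := hBRST.exists_rho_eq_of_mem_cycles hρ hρ_deg hφ
      exact ⟨⟨f, hf⟩, hfφ⟩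
  obtain ⟨B, hB⟩ := hBRST.exists_isCauchyForm hρ hD hS
  have hsurj := hBRST.causalData_surjective hρ hD hS
  obtain ⟨q, hq⟩ := hBRST.exists_phase_form hD hS
  refine ⟨hBRST.gammaSigma_mem hρ, hBRST.brstDen_le_brstNum hD, hBRST.solDen_le_solNum hD hS,
    hBRST.boundaries_le_cycles hρ, eG, eρ, heG, heρ, B, hB, fun B' hB' ↦ ?_, fun T ↦ ⟨fun hT ↦ ?_,
    fun hT u v ψ hψ ↦ ?_⟩, q,
    (q.comp (eG.trans eρ).symm.toLinearMap).compl₂ (eG.trans eρ).symm.toLinearMap, hq, ?_, ?_⟩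
  · refine LinearMap.ext fun φ ↦ LinearMap.ext fun ψ ↦ ?_
    obtain ⟨u, rfl⟩ := hsurj φ
    obtain ⟨v, rfl⟩ := hsurj ψ
    rw [hB' u v _ _ rfl rfl, hB u v _ _ rfl rfl]
  · intro φ ψ
    obtain ⟨u, rfl⟩ := hsurj φ
    obtain ⟨v, rfl⟩ := hsurj ψ
    rw [hB u v _ _ rfl rfl]
    exact hT u v _ rfl
  · rw [← hB u v (hρ.causalData hD u) ψ rfl hψ]
    exact hT _ _
  -- As `q_Σ` is `q` transported along `[ρ] ∘ [G_L]`, only its formula through `σ_Σ` needs proof.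
  -- Each cycle equals `ρ G u` exactly, not just modulo boundaries, for some `u` with `γ* u = 0`, so
  -- the formula reduces to the defining property of `B`.
  · have key : ∀ φ : hρ.cycles γ Pρ, ∃ u : brstNum γs P,
        ρ (hD.causal ⟨u, brstNum_le γs P u.2⟩) = φ ∧
          (eG.trans eρ) (QuotSpace.mk _ u) = QuotSpace.mk _ φ := fun φ ↦ by
      obtain ⟨f, hf, hfφ⟩ := hBRST.exists_rho_eq_of_mem_cycles hρ hρ_deg φ.2
      obtain ⟨u, hu⟩ := hBRST.exists_causal_eq_of_mem_solNum hD hS hf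
      obtain ⟨f', hf', hef⟩ := heG u
      obtain ⟨φ', hφ', heφ⟩ := heρ f'
      refine ⟨u, by rw [hu, hfφ], ?_⟩
      have hφφ : φ' = φ := Subtype.ext <| hφ'.trans <| (congrArg ρ (hf'.trans hu)).trans hfφ
      rw [LinearEquiv.trans_apply, hef, heφ, hφφ]
    intro φ ψ φ' ψ' hφ hψ
    obtain ⟨u, hu, heu⟩ := key φ
    obtain ⟨v, hv, hev⟩ := key ψ
    rw [LinearMap.compl₂_apply, LinearMap.comp_apply, ← heu, ← hev]
    simp only [LinearEquiv.coe_coe, LinearEquiv.symm_apply_apply]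
    rw [hq, hB _ _ φ' ψ' (hφ.trans hu.symm) (hψ.trans hv.symm)]
  · intro x y
    simp
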